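/- Let $n\ge 0$ be an integer. For $m\in\mathbb R$ let $S^m$ be the class of $a\in C^\infty(\mathbb R^n\times\mathbb R^n;\mathbb C)$ such that for all multi-indices $\alpha,\beta$ there is $A_{\alpha,\beta}$ with $$|\partial_x^\beta\partial_\xi^\alpha a(x,\xi)|\le A_{\alpha,\beta}(1+|\xi|)^{m-|\alpha|}\qquad\text{for all }x,\xi ;$$ the best such constants are the seminorms of $a$. For $a\in S^0$ and a Schwartz function $f$ put $$\Psi_a f(x)=\int a(x,\xi)\hat f(\xi)e^{2\pi i x\cdot\xi}\,d\xi,\qquad \hat f(\xi)=\int e^{-2\pi i x\cdot\xi}f(x)\,dx .$$ On tempered distributions $\Psi_a$ is defined by duality, $\langle\Psi_a f,\varphi\rangle=\langle f,\Psi_a^t\varphi\rangle$ for Schwartz $\varphi$, where $\Psi_a^t\varphi(y)=\int e^{-2\pi i y\cdot\xi}\int a(x,\xi)\varphi(x)e^{2\pi i x\cdot\xi}\,dx\,d\xi$. This extends the operator on Schwartz functions: for Schwartz $f$, the distribution $\Psi_a f$ is given by the integral above. Let $\lambda_m(x)=(1+|x|^2)^{-m/2}$, let $Q_\mu=\mu+[0,1]^n$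 for $\mu\in\mathbb Z^n$, and let $|||f|||=\sup_{\mu\in\mathbb Z^n}\|f\|_{L^2(Q_\mu)}$. (1) For every $m\in\mathbb R$ there is an integer $N=N(n,|m|)>0$ such that, for $a\in S^0$, $\Psi_a$ maps $L^2(\mathbb R^n,\lambda_m\,dx)$ into itself and $$\|\Psi_a f\|_{L^2(\lambda_m dx)}\le C\,\|f\|_{L^2(\lambda_m dx)}\qquad\text{for all }f\in L^2(\mathbb R^n,\lambda_m\,dx),$$ where $C$ depends only on $n$, $|m|$ and an upper bound for the seminorms of $a$ with $|\alpha|+|\beta|\le N$. (2) There is an integer $N=N(n)$ such that, for $a\in S^0$ and every measurable $f$ with $|||f|||<\infty$, the distribution $\Psi_a f$ is a locally integrable function and $$|||\Psi_a f|||\le C\,|||f|||,$$ where $C$ depends only on $n$ and an upper bound for the seminorms of $a$ with $|\alpha|+|\beta|\le N$. -/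

import Mathlib

open MeasureTheory
open scoped FourierTransform SchwartzMap ContDiff ENNReal NNReal

noncomputable section

/-- `ℝⁿ` with its Euclidean norm and Lebesgue measure. -/
abbrev Eu (n : ℕ) : Type := EuclideanSpace ℝ (Fin n)

/-- The partial derivative `∂a/∂x_j` of a function `a(x, ξ)` on `ℝⁿ × ℝⁿ`. -/
def partialX {n : ℕ} (j : Fin n) (a : Eu n × Eu n → ℂ) : Eu n × Eu n → ℂ :=
  fun p => fderiv ℝ a p (EuclideanSpace.single j 1, 0)

/-- The partial derivative `∂a/∂ξ_j` of a function `a(x, ξ)` on `ℝⁿ × ℝⁿ`. -/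
def partialXi {n : ℕ} (j : Fin n) (a : Eu n × Eu n → ℂ) : Eu n × Eu n → ℂ :=
  fun p => fderiv ℝ a p (0, EuclideanSpace.single j 1)

/-- `∂_x^β a` for a multi-index `β`. -/
def derivX {n : ℕ} (β : Fin n → ℕ) (a : Eu n × Eu n → ℂ) : Eu n × Eu n → ℂ :=
  (List.finRange n).foldr (fun j b => (partialX j)^[β j] b) a

/-- `∂_ξ^α a` for a multi-index `α`. -/
def derivXi {n : ℕ} (α : Fin n → ℕ) (a : Eu n × Eu n → ℂ) : Eu n × Eu n → ℂ :=
  (List.finRange n).foldr (fun j b => (partialXi j)^[α j] b) a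

/-- The length `|α|` of a multi-index. -/
def multiLength {n : ℕ} (α : Fin n → ℕ) : ℕ := ∑ j, α j

/-- `|∂_x^β ∂_ξ^α a(x, ξ)| ≤ A (1 + |ξ|)^(m - |α|)` for all `x` and `ξ`:
the seminorm of index `(α, β)` of the symbol `a` of order `m` is at most `A`. -/
def SymbolSeminormLE {n : ℕ} (m : ℝ) (α β : Fin n → ℕ) (a : Eu n × Eu n → ℂ) (A : ℝ) : Prop :=
  ∀ x ξ : Eu n, ‖derivX β (derivXi α a) (x, ξ)‖ ≤ A * (1 + ‖ξ‖) ^ (m - (multiLength α : ℝ))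

/-- The symbol class `S^m`. -/
def IsSymbol {n : ℕ} (m : ℝ) (a : Eu n × Eu n → ℂ) : Prop :=
  ContDiff ℝ ∞ a ∧ ∀ α β : Fin n → ℕ, ∃ A : ℝ, SymbolSeminormLE m α β a A

/-- All seminorms of the symbol `a` of order `m` with `|α| + |β| ≤ N` are at most `A`. -/
def SymbolBound {n : ℕ} (m : ℝ) (N : ℕ) (A : ℝ) (a : Eu n × Eu n → ℂ) : Prop :=
  ∀ α β : Fin n → ℕ, multiLength α + multiLength β ≤ N → SymbolSeminormLE m α β a A

/-- The character `e^{2πi x·ξ}`. -/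
def expChar {n : ℕ} (x ξ : Eu n) : ℂ :=
  Complex.exp (2 * Real.pi * Complex.I * ((inner ℝ x ξ : ℝ) : ℂ))

/-- `Ψ_a f(x) = ∫ a(x, ξ) f̂(ξ) e^{2πi x·ξ} dξ` for a Schwartz function `f`. -/
def psiOp {n : ℕ} (a : Eu n × Eu n → ℂ) (f : 𝓢(Eu n, ℂ)) : Eu n → ℂ :=
  fun x => ∫ ξ : Eu n, a (x, ξ) * 𝓕 (f : Eu n → ℂ) ξ * expChar x ξ

/-- The transpose of `Ψ_a` for the pairing `∫ f φ`, on Schwartz functions: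
`Ψ_aᵗ φ(y) = ∫ e^{-2πi y·ξ} (∫ a(x, ξ) φ(x) e^{2πi x·ξ} dx) dξ`. -/
def psiTranspose {n : ℕ} (a : Eu n × Eu n → ℂ) (φ : 𝓢(Eu n, ℂ)) : Eu n → ℂ :=
  𝓕 (fun ξ : Eu n => ∫ x : Eu n, a (x, ξ) * φ x * expChar x ξ)

/-- `Ψ_a f = g` in the sense of tempered distributions, for functions `f` and `g` on `ℝⁿ`:
`⟨Ψ_a f, φ⟩ = ⟨f, Ψ_aᵗ φ⟩` for all Schwartz functions `φ`, with absolutely convergent pairings.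
The function `g` is then determined by `a` and `f` almost everywhere. -/
def IsPsiOf {n : ℕ} (a : Eu n × Eu n → ℂ) (f g : Eu n → ℂ) : Prop :=
  LocallyIntegrable g ∧
  ∀ φ : 𝓢(Eu n, ℂ),
    Integrable (fun y => f y * psiTranspose a φ y) ∧
    Integrable (fun x => g x * φ x) ∧
    ∫ x, g x * φ x = ∫ y, f y * psiTranspose a φ y

/-- The weight `λ_m(x) = (1 + |x|²)^(-m/2)`. -/
def lambdaWeight {n : ℕ} (m : ℝ) (x : Eu n) : ℝ := (1 + ‖x‖ ^ 2) ^ (-m / 2)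

/-- The measure `λ_m(x) dx`. -/
def weightMeasure (n : ℕ) (m : ℝ) : Measure (Eu n) :=
  (volume : Measure (Eu n)).withDensity (fun x => ENNReal.ofReal (lambdaWeight m x))

/-- The unit cube `Q_μ = μ + [0, 1]ⁿ`. -/
def unitCube {n : ℕ} (μ : Fin n → ℤ) : Set (Eu n) :=
  {x | ∀ i, (μ i : ℝ) ≤ x i ∧ x i ≤ (μ i : ℝ) + 1}

/-- The norm `|||f||| = sup_μ ‖f‖_{L²(Q_μ)}`, with values in `[0, ∞]`. -/
def cubeNorm {n : ℕ} (f : Eu n → ℂ) : ℝ≥0∞ :=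
  ⨆ μ : Fin n → ℤ, eLpNorm f 2 ((volume : Measure (Eu n)).restrict (unitCube μ))

end

/-!
Symbols of order zero have bounded derivatives of every order in all variables, and this is all
that the argument uses: since partial derivatives of a smooth function commute, the seminorms with
`|α| + |β| ≤ N` control the total derivatives of `a` of order at most `N`
(`exists_derivBound_of_symbolBound`).

The transpose is `Ψ_aᵗ φ = 𝓕 H` with `H(ξ) = ∫ a(x, ξ) φ(x) e^{2πi x·ξ} dx`. For each fixed `ξ` the
function `x ↦ (1 + |x|²)⁻⁽ⁿ⁺¹⁾ a(x, ξ)` has an integrable Fourier transform, dominated uniformly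
in `ξ` by a multiple of `(1 + |l|²)⁻⁽ⁿ⁺¹⁾`. Hence `|H|` is dominated by the convolution of an
integrable function with the modulus of the Fourier transform of `(1 + |x|²)ⁿ⁺¹ φ`, and Plancherel's
identity bounds `Ψ_aᵗ` from a weighted `L²` space to `L²` (`exists_eLpNorm_oscInt_le`). Weights are
lost here, but the final estimates are local and do not suffer from this loss. Multiplying
`Ψ_aᵗ φ` by `y_j` differentiates the symbol in `ξ_j` or multiplies `φ` by `x_j`, so weights of any
order can be put on the left; as translates of `a` satisfy the same bounds, the weights may be
centred at any point `s`, with constants independent of `s`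
(`exists_eLpNorm_bracketSq_sub_pow_smul_psiTranspose_le`).

By duality, the distribution `Ψ_a f` is a function whenever `f` has polynomial growth in the `L²`
sense (`IsBddSymbol.exists_isPsiOf`). Testing against Schwartz functions cut off near `s`, where a
weight centred at `s` is bounded, gives
`‖Ψ_a f‖_{L²(B(s, R))} ≤ C ‖(1 + |y - s|²)⁻ᴸ f‖_{L²}` (`exists_eLpNorm_ball_le_decayNorm`). Both
bounds follow from this one. Squared and integrated in `s` against `λ_m`, it gives the weighted
bound, by Tonelli's theorem and Peetre's inequality for `λ_m`. With `s ∈ ℤⁿ` and `R` so large that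
the ball contains the unit cube at `s`, it gives the bound in the cube norm, because the right-hand
side is an average of the `L²` norms of `f` over unit balls, each covered by `3ⁿ` unit cubes.

For a Schwartz function `f`, Fubini's theorem identifies the integral formula with the definition
by duality; the integral is itself of the form `H`, with the roles of `x` and `ξ` exchanged.
-/

/-! ### Symbols with bounded derivatives -/

/-- All total derivatives of `b` of order at most `N` are bounded by `A`, uniformly. -/
def DerivBound {V : Type*} [NormedAddCommGroup V] [NormedSpace ℝ V]
    (N : ℕ) (A : ℝ) (b : V → ℂ) : Prop :=
  ∀ k ≤ N, ∀ p, ‖iteratedFDeriv ℝ k b p‖ ≤ A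

/-- The class `S⁰₀₀`: smooth functions on `ℝⁿ × ℝⁿ`, all of whose derivatives are bounded. -/
def IsBddSymbol {n : ℕ} (b : Eu n × Eu n → ℂ) : Prop :=
  ContDiff ℝ ∞ b ∧ ∀ N : ℕ, ∃ A : ℝ, DerivBound N A b

/-- The derivative in a fixed direction `v`, as a self-map of the space of smooth functions. -/
noncomputable def dirDeriv {V : Type*} [NormedAddCommGroup V] [NormedSpace ℝ V] (v : V)
    (a : {a : V → ℂ // ContDiff ℝ ∞ a}) : {a : V → ℂ // ContDiff ℝ ∞ a} :=
  ⟨fun p => fderiv ℝ a.1 p v, (a.2.fderiv_right (m := ∞) (by norm_cast)).clm_apply contDiff_const⟩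

theorem dirDeriv_commute {V : Type*} [NormedAddCommGroup V] [NormedSpace ℝ V] (v w : V) :
    Function.Commute (dirDeriv v) (dirDeriv w) := by
  intro a
  have key : ∀ (u u' : V) (p : V),
      fderiv ℝ (fun q => fderiv ℝ a.1 q u) p u' = fderiv ℝ (fderiv ℝ a.1) p u' u := by
    intro u u' p
    have hd : DifferentiableAt ℝ (fderiv ℝ a.1) p :=
      ((a.2.fderiv_right (m := ∞) (by norm_cast)).differentiable (by norm_num)) p
    rw [fderiv_clm_apply hd (differentiableAt_const _)]
    simp
  apply Subtype.ext
  funext p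
  change fderiv ℝ (fun q => fderiv ℝ a.1 q w) p v = fderiv ℝ (fun q => fderiv ℝ a.1 q v) p w
  rw [key, key]
  exact (a.2.contDiffAt.isSymmSndFDerivAt (by simpa using ENat.LEInfty.out)).eq v w

/-- An extra factor `P j` in a product of powers of commuting maps raises one exponent. -/
theorem foldr_iterate_apply_commute {ι S : Type*} [DecidableEq ι] (P : ι → S → S)
    (hP : ∀ i j, Function.Commute (P i) (P j)) (j : ι) (s : S) :
    ∀ (l : List ι), l.Nodup → j ∈ l → ∀ α : ι → ℕ,
      l.foldr (fun i b => (P i)^[α i] b) (P j s) =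
        l.foldr (fun i b => (P i)^[(α + Pi.single j 1 : ι → ℕ) i] b) s := by
  have comm : ∀ (l : List ι) (α : ι → ℕ),
      l.foldr (fun i b => (P i)^[α i] b) (P j s) =
        P j (l.foldr (fun i b => (P i)^[α i] b) s) := by
    intro l α
    induction l with
    | nil => rfl
    | cons i l ih =>
      simp only [List.foldr_cons, ih]
      exact ((hP i j).iterate_left (α i)) _
  intro l
  induction l with
  | nil => intro _ h; simp at h
  | cons i l ih =>
    intro hl hj α
    rw [List.nodup_cons] at hl
    by_cases hij : j = i
    · subst hij
      have hrest : ∀ (l' : List ι) (t : S), j ∉ l' →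
          l'.foldr (fun i b => (P i)^[(α + Pi.single j 1 : ι → ℕ) i] b) t =
            l'.foldr (fun i b => (P i)^[α i] b) t := by
        intro l' t
        induction l' with
        | nil => intro _; rfl
        | cons i' l' ih' =>
          intro h
          rw [List.mem_cons, not_or] at h
          simp only [List.foldr_cons, ih' h.2]
          simp [Pi.single_eq_of_ne (Ne.symm h.1)]
      simp only [List.foldr_cons]
      rw [comm, hrest l s hl.1]
      simp [Function.iterate_succ_apply]
    · have hj' : j ∈ l := by
        rcases List.mem_cons.1 hj with h | h
        · exact absurd h hij
        · exact h
      simp only [List.foldr_cons, ih hl.2 hj' α]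
      simp [Pi.single_eq_of_ne (Ne.symm hij)]

/-- The `2n` coordinate directions of `ℝⁿ × ℝⁿ`. -/
noncomputable def coordDir {n : ℕ} : Fin n ⊕ Fin n → Eu n × Eu n
  | .inl j => (EuclideanSpace.single j 1, 0)
  | .inr j => (0, EuclideanSpace.single j 1)

/-- Every iterated coordinate derivative of a smooth function is a `∂_x^β ∂_ξ^α`. -/
theorem exists_multiIndex_of_list {n : ℕ} (l : List (Fin n ⊕ Fin n)) :
    ∃ α β : Fin n → ℕ, multiLength α + multiLength β = l.length ∧
      ∀ a : {a : Eu n × Eu n → ℂ // ContDiff ℝ ∞ a},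
        (l.foldl (fun b j => dirDeriv (coordDir j) b) a).1 = derivX β (derivXi α a.1) := by
  let TX : (Fin n → ℕ) → {a : Eu n × Eu n → ℂ // ContDiff ℝ ∞ a} → _ := fun β a =>
    (List.finRange n).foldr (fun j b => (dirDeriv (coordDir (Sum.inl j)))^[β j] b) a
  let TXi : (Fin n → ℕ) → {a : Eu n × Eu n → ℂ // ContDiff ℝ ∞ a} → _ := fun α a =>
    (List.finRange n).foldr (fun j b => (dirDeriv (coordDir (Sum.inr j)))^[α j] b) a
  have hX : ∀ β a, (TX β a).1 = derivX β a.1 := by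
    intro β a
    have it : ∀ (j : Fin n) (k : ℕ) (b : {a : Eu n × Eu n → ℂ // ContDiff ℝ ∞ a}),
        ((dirDeriv (coordDir (Sum.inl j)))^[k] b).1 = (partialX j)^[k] b.1 := by
      intro j k
      induction k with
      | zero => intro b; rfl
      | succ k ih => intro b; rw [Function.iterate_succ_apply, Function.iterate_succ_apply, ih]; rfl
    have : ∀ l : List (Fin n),
        (l.foldr (fun j b => (dirDeriv (coordDir (Sum.inl j)))^[β j] b) a).1 =
          l.foldr (fun j b => (partialX j)^[β j] b) a.1 := by
      intro l
      induction l with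
      | nil => rfl
      | cons j l ih => simp only [List.foldr_cons, it, ih]
    exact this _
  have hXi : ∀ α a, (TXi α a).1 = derivXi α a.1 := by
    intro α a
    have it : ∀ (j : Fin n) (k : ℕ) (b : {a : Eu n × Eu n → ℂ // ContDiff ℝ ∞ a}),
        ((dirDeriv (coordDir (Sum.inr j)))^[k] b).1 = (partialXi j)^[k] b.1 := by
      intro j k
      induction k with
      | zero => intro b; rfl
      | succ k ih => intro b; rw [Function.iterate_succ_apply, Function.iterate_succ_apply, ih]; rfl
    have : ∀ l : List (Fin n),
        (l.foldr (fun j b => (dirDeriv (coordDir (Sum.inr j)))^[α j] b) a).1 =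
          l.foldr (fun j b => (partialXi j)^[α j] b) a.1 := by
      intro l
      induction l with
      | nil => rfl
      | cons j l ih => simp only [List.foldr_cons, it, ih]
    exact this _
  have hlen : ∀ (γ : Fin n → ℕ) (j : Fin n),
      multiLength (γ + Pi.single j 1) = multiLength γ + 1 := by
    intro γ j
    simp [multiLength, Finset.sum_add_distrib]
  suffices h : ∃ α β : Fin n → ℕ, multiLength α + multiLength β = l.length ∧
      ∀ a : {a : Eu n × Eu n → ℂ // ContDiff ℝ ∞ a},
        l.foldl (fun b j => dirDeriv (coordDir j) b) a = TX β (TXi α a) by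
    obtain ⟨α, β, h1, h2⟩ := h
    exact ⟨α, β, h1, fun a => by rw [h2, hX, hXi]⟩
  induction l with
  | nil =>
    refine ⟨0, 0, by simp [multiLength], fun a => ?_⟩
    simp only [List.foldl_nil]
    have hz : ∀ (d : Fin n → Fin n ⊕ Fin n) (l : List (Fin n)),
        l.foldr (fun j b => (dirDeriv (coordDir (d j)))^[(0 : Fin n → ℕ) j] b) a = a := by
      intro d l
      induction l with
      | nil => rfl
      | cons j l ih => simp [List.foldr_cons]
    simp only [TX, TXi]
    rw [hz Sum.inr, hz Sum.inl]
  | cons j l ih =>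
    obtain ⟨α, β, h1, h2⟩ := ih
    cases j with
    | inr j =>
      refine ⟨α + Pi.single j 1, β, by rw [hlen, List.length_cons]; omega, fun a => ?_⟩
      rw [List.foldl_cons, h2]
      congr 1
      exact foldr_iterate_apply_commute (fun j => dirDeriv (coordDir (Sum.inr j)))
        (fun _ _ => dirDeriv_commute _ _) j a _ (List.nodup_finRange n) (List.mem_finRange j) α
    | inl j =>
      refine ⟨α, β + Pi.single j 1, by rw [hlen, List.length_cons]; omega, fun a => ?_⟩
      rw [List.foldl_cons, h2]
      have hc : TXi α (dirDeriv (coordDir (Sum.inl j)) a) =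
          dirDeriv (coordDir (Sum.inl j)) (TXi α a) := by
        have : ∀ l : List (Fin n),
            l.foldr (fun i b => (dirDeriv (coordDir (Sum.inr i)))^[α i] b)
              (dirDeriv (coordDir (Sum.inl j)) a) =
            dirDeriv (coordDir (Sum.inl j))
              (l.foldr (fun i b => (dirDeriv (coordDir (Sum.inr i)))^[α i] b) a) := by
          intro l
          induction l with
          | nil => rfl
          | cons i l ih =>
            simp only [List.foldr_cons, ih]
            exact ((dirDeriv_commute (coordDir (Sum.inr i))
              (coordDir (Sum.inl j))).iterate_left (α i)) _
        exact this _
      rw [hc]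
      exact foldr_iterate_apply_commute (fun j => dirDeriv (coordDir (Sum.inl j)))
        (fun _ _ => dirDeriv_commute _ _) j _ _ (List.nodup_finRange n) (List.mem_finRange j) β

/-- A real-linear form on `ℝⁿ × ℝⁿ` is determined by its values on the coordinate directions. -/
theorem clm_eq_sum_coordDir {n : ℕ} (T : Eu n × Eu n →L[ℝ] ℂ) :
    T = ∑ j : Fin n, (T (coordDir (.inl j)) •
          ((Complex.ofRealCLM.comp (EuclideanSpace.proj j)).comp
            (ContinuousLinearMap.fst ℝ (Eu n) (Eu n))) +
        T (coordDir (.inr j)) •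
          ((Complex.ofRealCLM.comp (EuclideanSpace.proj j)).comp
            (ContinuousLinearMap.snd ℝ (Eu n) (Eu n)))) := by
  have hsum : ∀ x : Eu n, x = ∑ j, x j • EuclideanSpace.single j (1 : ℝ) := by
    intro x
    simpa using ((EuclideanSpace.basisFun (Fin n) ℝ).sum_repr x).symm
  ext x
  · simp only [ContinuousLinearMap.comp_apply, ContinuousLinearMap.inl_apply,
      sum_apply, add_apply, smul_apply]
    conv_lhs => rw [hsum x]
    have : ((∑ j, x j • EuclideanSpace.single j (1 : ℝ), 0) : Eu n × Eu n) =
        ∑ j, x j • coordDir (.inl j) := by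
      ext <;> simp [coordDir, Prod.fst_sum, Prod.snd_sum]
    rw [this, map_sum]
    simp [mul_comm]
  · simp only [ContinuousLinearMap.comp_apply, ContinuousLinearMap.inr_apply,
      sum_apply, add_apply, smul_apply]
    conv_lhs => rw [hsum x]
    have : ((0, ∑ j, x j • EuclideanSpace.single j (1 : ℝ)) : Eu n × Eu n) =
        ∑ j, x j • coordDir (.inr j) := by
      ext <;> simp [coordDir, Prod.fst_sum, Prod.snd_sum]
    rw [this, map_sum]
    simp [mul_comm]

/-- The total derivative of order `k` is controlled by the iterated coordinate derivatives. -/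
theorem exists_norm_iteratedFDeriv_le_of_coordDir {n : ℕ} (k : ℕ) :
    ∃ C : ℝ, 0 ≤ C ∧ ∀ (a : {a : Eu n × Eu n → ℂ // ContDiff ℝ ∞ a}) (A : ℝ) (p : Eu n × Eu n),
      (∀ l : List (Fin n ⊕ Fin n), l.length = k →
        ‖(l.foldl (fun b j => dirDeriv (coordDir j) b) a).1 p‖ ≤ A) →
      ‖iteratedFDeriv ℝ k a.1 p‖ ≤ C * A := by
  induction k with
  | zero =>
    refine ⟨1, zero_le_one, fun a A p h => ?_⟩
    simpa using h [] rfl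
  | succ k ih =>
    obtain ⟨C, hC, ih⟩ := ih
    let px : Fin n → (Eu n × Eu n →L[ℝ] ℂ) := fun j =>
      (Complex.ofRealCLM.comp (EuclideanSpace.proj j)).comp
        (ContinuousLinearMap.fst ℝ (Eu n) (Eu n))
    let py : Fin n → (Eu n × Eu n →L[ℝ] ℂ) := fun j =>
      (Complex.ofRealCLM.comp (EuclideanSpace.proj j)).comp
        (ContinuousLinearMap.snd ℝ (Eu n) (Eu n))
    refine ⟨∑ j, (‖px j‖ + ‖py j‖) * C, by positivity, fun a A p h => ?_⟩
    rw [← norm_iteratedFDeriv_fderiv]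
    have e : fderiv ℝ a.1 = fun q => ∑ j : Fin n,
        ((dirDeriv (coordDir (.inl j)) a).1 q • px j +
          (dirDeriv (coordDir (.inr j)) a).1 q • py j) := by
      funext q
      exact clm_eq_sum_coordDir _
    have hsm : ∀ (i : Fin n ⊕ Fin n) (c : Eu n × Eu n →L[ℝ] ℂ),
        ContDiff ℝ k (fun q => (dirDeriv (coordDir i) a).1 q • c) := fun i c =>
      ((dirDeriv (coordDir i) a).2.of_le (by exact_mod_cast le_top)).smul contDiff_const
    have hone : ∀ (i : Fin n ⊕ Fin n) (c : Eu n × Eu n →L[ℝ] ℂ),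
        ‖iteratedFDeriv ℝ k (fun q => (dirDeriv (coordDir i) a).1 q • c) p‖ ≤ ‖c‖ * (C * A) := by
      intro i c
      let S : ℂ →L[ℝ] (Eu n × Eu n →L[ℝ] ℂ) :=
        (ContinuousLinearMap.toSpanSingleton ℂ c).restrictScalars ℝ
      have hS : ‖S‖ ≤ ‖c‖ := by
        refine ContinuousLinearMap.opNorm_le_bound _ (norm_nonneg _) fun z => ?_
        simp [S, norm_smul, mul_comm]
      have := S.norm_iteratedFDeriv_comp_left (n := k) (x := p) (N := ∞)
        (dirDeriv (coordDir i) a).2.contDiffAt (by exact_mod_cast le_top)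
      refine this.trans ?_
      refine mul_le_mul hS (ih _ A p ?_) (norm_nonneg _) (norm_nonneg _)
      intro l hl
      exact h (i :: l) (by simp [hl])
    rw [e, iteratedFDeriv_sum (fun j _ => (hsm _ _).add (hsm _ _)), Finset.sum_mul]
    rw [show ∀ F : Fin n → (Eu n × Eu n → (Eu n × Eu n) [×k]→L[ℝ] (Eu n × Eu n →L[ℝ] ℂ)),
      (∑ j, F j) p = ∑ j, F j p from fun F => Finset.sum_apply _ _ _]
    refine (norm_sum_le _ _).trans (Finset.sum_le_sum fun j _ => ?_)
    have := iteratedFDeriv_add_apply (i := k) (x := p) (hsm (.inl j) (px j)).contDiffAt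
      (hsm (.inr j) (py j)).contDiffAt
    have e2 : iteratedFDeriv ℝ k (fun q => (dirDeriv (coordDir (.inl j)) a).1 q • px j +
          (dirDeriv (coordDir (.inr j)) a).1 q • py j) p = _ := this
    rw [e2]
    refine (norm_add_le _ _).trans ?_
    linarith [hone (.inl j) (px j), hone (.inr j) (py j)]

/-- The seminorms of order at most `N` of a symbol of order zero bound its total derivatives. -/
theorem exists_derivBound_of_symbolBound (n N : ℕ) :
    ∃ C : ℝ, 0 ≤ C ∧ ∀ (a : Eu n × Eu n → ℂ) (A : ℝ), ContDiff ℝ ∞ a → SymbolBound 0 N A a →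
      DerivBound N (C * A) a := by
  choose C hC h using fun k => exists_norm_iteratedFDeriv_le_of_coordDir (n := n) k
  refine ⟨∑ k ∈ Finset.range (N + 1), C k, Finset.sum_nonneg fun k _ => hC k, ?_⟩
  intro a A ha hA k hk p
  have hA0 : 0 ≤ A := by
    have := (norm_nonneg _).trans (hA 0 0 (by simp [multiLength]) 0 0)
    simpa using this
  refine (h k ⟨a, ha⟩ A p ?_).trans ?_
  · intro l hl
    obtain ⟨α, β, h1, h2⟩ := exists_multiIndex_of_list l
    rw [h2]
    refine (hA α β (by omega) p.1 p.2).trans ?_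
    refine mul_le_of_le_one_right hA0 (Real.rpow_le_one_of_one_le_of_nonpos ?_ ?_)
    · linarith [norm_nonneg p.2]
    · simp
  · refine mul_le_mul_of_nonneg_right ?_ hA0
    exact Finset.single_le_sum (f := C) (fun k _ => hC k) (Finset.mem_range.2 (by omega))

theorem IsSymbol.isBddSymbol {n : ℕ} {a : Eu n × Eu n → ℂ} (ha : IsSymbol 0 a) :
    IsBddSymbol a := by
  classical
  refine ⟨ha.1, fun N => ?_⟩
  choose A hA using ha.2
  obtain ⟨C, -, hC⟩ := exists_derivBound_of_symbolBound n N
  let S : Finset (Fin n → ℕ) := Fintype.piFinset fun _ => Finset.range (N + 1)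
  refine ⟨_, hC a (∑ α ∈ S, ∑ β ∈ S, |A α β|) ha.1 ?_⟩
  intro α β hαβ x ξ
  have mem : ∀ γ : Fin n → ℕ, multiLength γ ≤ N → γ ∈ S := by
    intro γ hγ
    refine Fintype.mem_piFinset.2 fun j => Finset.mem_range.2 ?_
    have := Finset.single_le_sum (f := γ) (fun i _ => Nat.zero_le _) (Finset.mem_univ j)
    unfold multiLength at hγ
    omega
  refine (hA α β x ξ).trans (mul_le_mul_of_nonneg_right ?_ (by positivity))
  refine (le_abs_self _).trans ?_
  refine (Finset.single_le_sum (f := fun β => |A α β|) (fun _ _ => abs_nonneg _)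
    (mem β (by omega))).trans ?_
  exact Finset.single_le_sum (f := fun α => ∑ β ∈ S, |A α β|)
    (fun _ _ => Finset.sum_nonneg fun _ _ => abs_nonneg _) (mem α (by omega))

/-! ### The weights `(1 + |x|²)ᵏ` and decay of Fourier transforms -/

/-- The squared Japanese bracket `1 + |x|²`. -/
noncomputable def bracketSq {V : Type*} [NormedAddCommGroup V] (x : V) : ℝ := 1 + ‖x‖ ^ 2

theorem one_le_bracketSq {V : Type*} [NormedAddCommGroup V] (x : V) : 1 ≤ bracketSq x := by
  unfold bracketSq; linarith [sq_nonneg ‖x‖]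

theorem bracketSq_pos {V : Type*} [NormedAddCommGroup V] (x : V) : 0 < bracketSq x :=
  zero_lt_one.trans_le (one_le_bracketSq x)

theorem norm_iteratedFDeriv_clm_le {V W : Type*} [NormedAddCommGroup V] [NormedSpace ℝ V]
    [NormedAddCommGroup W] [NormedSpace ℝ W] (T : V →L[ℝ] W) (m : ℕ) (x : V) :
    ‖iteratedFDeriv ℝ m T x‖ ≤ ‖T‖ * (1 + ‖x‖) := by
  have h0 : ‖T‖ ≤ ‖T‖ * (1 + ‖x‖) :=
    le_mul_of_one_le_right (norm_nonneg _) (by linarith [norm_nonneg x])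
  match m with
  | 0 =>
    rw [norm_iteratedFDeriv_zero]
    exact (T.le_opNorm x).trans (mul_le_mul_of_nonneg_left (by linarith) (norm_nonneg _))
  | m + 1 =>
    rw [← norm_iteratedFDeriv_fderiv]
    have : fderiv ℝ T = fun _ => T := by funext y; exact T.fderiv
    rw [this]
    match m with
    | 0 => simpa using h0
    | m + 1 =>
      rw [iteratedFDeriv_succ_const]
      simpa using (norm_nonneg _).trans h0

section Weights

variable {V : Type*} [NormedAddCommGroup V] [InnerProductSpace ℝ V]

theorem contDiff_bracketSq {r : WithTop ℕ∞} : ContDiff ℝ r (bracketSq : V → ℝ) :=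
  contDiff_const.add (contDiff_norm_sq ℝ)

theorem contDiff_inv_bracketSq_pow {r : WithTop ℕ∞} (k : ℕ) :
    ContDiff ℝ r (fun x : V => (bracketSq x ^ k)⁻¹) :=
  (contDiff_bracketSq.pow k).inv fun x => (pow_pos (bracketSq_pos x) k).ne'

theorem fderiv_inv_bracketSq_pow (k : ℕ) :
    fderiv ℝ (fun x : V => (bracketSq x ^ k)⁻¹) =
      fun x => (bracketSq x ^ (k + 1))⁻¹ • ((-(2 * k) : ℝ) • innerSL ℝ (E := V)) x := by
  funext x
  have h1 : HasFDerivAt (bracketSq : V → ℝ) (2 • innerSL ℝ x) x :=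
    (hasStrictFDerivAt_norm_sq x).hasFDerivAt.const_add 1
  have h2 := (hasDerivAt_zpow (-(k : ℤ)) (bracketSq x)
    (Or.inl (bracketSq_pos x).ne')).comp_hasFDerivAt x h1
  have e : (fun y : V => (bracketSq y ^ k)⁻¹) = (fun t : ℝ => t ^ (-(k : ℤ))) ∘ bracketSq := by
    funext y; simp
  rw [e, h2.fderiv]
  have e3 : bracketSq x ^ (-(k : ℤ) - 1) = (bracketSq x ^ (k + 1))⁻¹ := by
    rw [show (-(k : ℤ) - 1) = -((k + 1 : ℕ) : ℤ) by push_cast; ring, zpow_neg, zpow_natCast]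
  rw [e3]
  ext y
  simp
  ring

/-- Each derivative of `(1 + |x|²)⁻ᵏ` decays at least as fast as the function itself. -/
theorem exists_norm_iteratedFDeriv_inv_bracketSq_pow_le (i : ℕ) : ∀ k : ℕ, ∃ C : ℝ, 0 ≤ C ∧
    ∀ x : V, ‖iteratedFDeriv ℝ i (fun x : V => (bracketSq x ^ k)⁻¹) x‖ ≤
      C * (bracketSq x ^ k)⁻¹ := by
  induction i using Nat.strong_induction_on with
  | _ i ih =>
    intro k
    match i with
    | 0 =>
      refine ⟨1, zero_le_one, fun x => ?_⟩
      rw [norm_iteratedFDeriv_zero, one_mul, Real.norm_of_nonneg]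
      exact inv_nonneg.2 (pow_pos (bracketSq_pos x) k).le
    | i + 1 =>
      have ih' : ∀ j : ℕ, ∃ C : ℝ, 0 ≤ C ∧ (j ≤ i → ∀ x : V,
          ‖iteratedFDeriv ℝ j (fun x : V => (bracketSq x ^ (k + 1))⁻¹) x‖ ≤
            C * (bracketSq x ^ (k + 1))⁻¹) := by
        intro j
        by_cases hj : j ≤ i
        · obtain ⟨C, hC, h⟩ := ih j (by omega) (k + 1)
          exact ⟨C, hC, fun _ => h⟩
        · exact ⟨0, le_rfl, fun h => absurd h hj⟩
      choose C hC h using ih'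
      set T : V →L[ℝ] V →L[ℝ] ℝ := (-(2 * k) : ℝ) • innerSL ℝ (E := V) with hT
      refine ⟨∑ j ∈ Finset.range (i + 1), (i.choose j : ℝ) * C j * (‖T‖ * 2),
        Finset.sum_nonneg fun j _ => by have := hC j; positivity, fun x => ?_⟩
      rw [← norm_iteratedFDeriv_fderiv, fderiv_inv_bracketSq_pow]
      refine (norm_iteratedFDeriv_smul_le (N := ∞) (contDiff_inv_bracketSq_pow (k + 1))
        T.contDiff x (by exact_mod_cast le_top)).trans ?_
      rw [Finset.sum_mul]
      refine Finset.sum_le_sum fun j hj => ?_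
      have hj' : j ≤ i := by have := Finset.mem_range.1 hj; omega
      have hb := bracketSq_pos x
      have h2 : 1 + ‖x‖ ≤ 2 * bracketSq x := by
        unfold bracketSq; nlinarith [sq_nonneg (‖x‖ - 1), sq_nonneg ‖x‖]
      calc (i.choose j : ℝ) * ‖iteratedFDeriv ℝ j (fun x : V => (bracketSq x ^ (k + 1))⁻¹) x‖ *
            ‖iteratedFDeriv ℝ (i - j) T x‖
          ≤ (i.choose j : ℝ) * (C j * (bracketSq x ^ (k + 1))⁻¹) *
              (‖T‖ * (2 * bracketSq x)) := by
            have := hC j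
            gcongr
            · exact h j hj' x
            · exact (norm_iteratedFDeriv_clm_le T _ x).trans (by gcongr)
        _ = (i.choose j : ℝ) * C j * (‖T‖ * 2) * (bracketSq x ^ k)⁻¹ := by
            rw [pow_succ]
            field_simp

end Weights

/-- Peetre's inequality. -/
theorem bracketSq_add_le {V : Type*} [NormedAddCommGroup V] (x y : V) :
    bracketSq (x + y) ≤ 2 * bracketSq x * bracketSq y := by
  unfold bracketSq
  have h := norm_add_le x y
  have h2 : ‖x + y‖ ^ 2 ≤ (‖x‖ + ‖y‖) ^ 2 := pow_le_pow_left₀ (norm_nonneg _) h 2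
  nlinarith [sq_nonneg (‖x‖ - ‖y‖), sq_nonneg (‖x‖ * ‖y‖), sq_nonneg ‖x‖, sq_nonneg ‖y‖]

theorem bracketSq_neg {V : Type*} [NormedAddCommGroup V] (x : V) :
    bracketSq (-x) = bracketSq x := by
  simp [bracketSq]

theorem integrable_inv_bracketSq_pow {n k : ℕ} (hk : n < 2 * k) :
    Integrable (fun x : Eu n => (bracketSq x ^ k)⁻¹) := by
  have := integrable_rpow_neg_one_add_norm_sq (E := Eu n) (μ := volume) (r := 2 * k)
    (by rw [finrank_euclideanSpace_fin]; exact_mod_cast hk)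
  refine this.congr (Filter.Eventually.of_forall fun x => ?_)
  change bracketSq x ^ (-(2 * k) / 2 : ℝ) = _
  rw [show (-(2 * k) / 2 : ℝ) = -(k : ℝ) by ring, Real.rpow_neg (bracketSq_pos x).le,
    Real.rpow_natCast]

theorem DerivBound.nonneg {V : Type*} [NormedAddCommGroup V] [NormedSpace ℝ V]
    {N : ℕ} {A : ℝ} {b : V → ℂ} (h : DerivBound N A b) : 0 ≤ A :=
  (norm_nonneg _).trans (h 0 (Nat.zero_le _) 0)

theorem DerivBound.mono {V : Type*} [NormedAddCommGroup V] [NormedSpace ℝ V]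
    {N M : ℕ} {A : ℝ} {b : V → ℂ} (h : DerivBound N A b) (hM : M ≤ N) : DerivBound M A b :=
  fun k hk => h k (hk.trans hM)

theorem DerivBound.slice {n N : ℕ} {A : ℝ} {b : Eu n × Eu n → ℂ} (hb : ContDiff ℝ ∞ b)
    (h : DerivBound N A b) (ξ : Eu n) : DerivBound N A (fun x => b (x, ξ)) := by
  intro k hk x
  have e : (fun x => b (x, ξ)) =
      (fun p => b (p + (0, ξ))) ∘ ContinuousLinearMap.inl ℝ (Eu n) (Eu n) := by
    funext y; simp
  have hs : ContDiff ℝ ∞ (fun p => b (p + (0, ξ))) := hb.comp (contDiff_id.add contDiff_const)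
  rw [e, ContinuousLinearMap.iteratedFDeriv_comp_right _ hs x (by exact_mod_cast le_top),
    iteratedFDeriv_comp_add_right]
  refine (ContinuousMultilinearMap.norm_compContinuousLinearMap_le _ _).trans ?_
  refine (mul_le_of_le_one_right (norm_nonneg _) ?_).trans (h k hk _)
  refine Finset.prod_le_one (fun _ _ => norm_nonneg _) fun _ _ => ?_
  exact ContinuousLinearMap.norm_inl_le_one ℝ _ _

theorem DerivBound.norm_iteratedFDeriv_mul_le {V : Type*} [NormedAddCommGroup V] [NormedSpace ℝ V]
    {N : ℕ} {A : ℝ} {f θ : V → ℂ} (h : DerivBound N A f) (hf : ContDiff ℝ ∞ f)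
    (hθ : ContDiff ℝ ∞ θ) {k : ℕ} (hk : k ≤ N) (x : V) :
    ‖iteratedFDeriv ℝ k (fun x => f x * θ x) x‖ ≤
      A * ∑ i ∈ Finset.range (k + 1), (k.choose i : ℝ) * ‖iteratedFDeriv ℝ (k - i) θ x‖ := by
  refine (_root_.norm_iteratedFDeriv_mul_le (N := ∞) hf hθ x (by exact_mod_cast le_top)).trans ?_
  rw [Finset.mul_sum]
  refine Finset.sum_le_sum fun i hi => ?_
  have hi' : i ≤ k := by have := Finset.mem_range.1 hi; omega
  rw [mul_comm (k.choose i : ℝ), mul_assoc]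
  exact mul_le_mul_of_nonneg_right (h i (by omega) x) (by positivity)

theorem DerivBound.integrable_iteratedFDeriv_mul {n N : ℕ} {A : ℝ} {f θ : Eu n → ℂ}
    (h : DerivBound N A f) (hf : ContDiff ℝ ∞ f) (hθ : ContDiff ℝ ∞ θ)
    (hint : ∀ i, Integrable (fun x => ‖iteratedFDeriv ℝ i θ x‖)) {k : ℕ} (hk : k ≤ N) :
    Integrable (fun x => ‖iteratedFDeriv ℝ k (fun x => f x * θ x) x‖) := by
  have hs : ContDiff ℝ ∞ (fun x => f x * θ x) := hf.mul hθ
  refine Integrable.mono' (g := fun x => A * ∑ i ∈ Finset.range (k + 1),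
    (k.choose i : ℝ) * ‖iteratedFDeriv ℝ (k - i) θ x‖) ?_ ?_ ?_
  · exact (integrable_finsetSum _ fun i _ => (hint _).const_mul _).const_mul _
  · exact (hs.continuous_iteratedFDeriv (by exact_mod_cast le_top)).norm.aestronglyMeasurable
  · refine Filter.Eventually.of_forall fun x => ?_
    rw [norm_norm]
    exact h.norm_iteratedFDeriv_mul_le hf hθ hk x

/-- Multiplying a function with integrable derivatives by one with bounded derivatives gives
a Fourier transform of polynomial decay, uniformly in the second factor. -/
theorem exists_bracketSq_pow_mul_norm_fourier_le {n : ℕ} {θ : Eu n → ℂ} (hθ : ContDiff ℝ ∞ θ)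
    (hint : ∀ i, Integrable (fun x => ‖iteratedFDeriv ℝ i θ x‖)) (M : ℕ) :
    ∃ C : ℝ, 0 ≤ C ∧ ∀ (f : Eu n → ℂ) (A : ℝ), ContDiff ℝ ∞ f → DerivBound (2 * M) A f →
      ∀ l : Eu n, bracketSq l ^ M * ‖𝓕 (fun x => f x * θ x) l‖ ≤ C * A := by
  let I : ℕ → ℝ := fun p => ∫ x, ∑ i ∈ Finset.range (p + 1),
    (p.choose i : ℝ) * ‖iteratedFDeriv ℝ (p - i) θ x‖
  have hI : ∀ p, 0 ≤ I p := fun p =>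
    integral_nonneg fun x => Finset.sum_nonneg fun i _ => by positivity
  have hcoord : ∀ m : ℕ, ∃ C : ℝ, 0 ≤ C ∧ ∀ (f : Eu n → ℂ) (A : ℝ), ContDiff ℝ ∞ f →
      DerivBound m A f → ∀ l : Eu n, ‖l‖ ^ m * ‖𝓕 (fun x => f x * θ x) l‖ ≤ C * A := by
    intro m
    refine ⟨2 ^ m * ∑ p ∈ Finset.range (m + 1), I p,
      mul_nonneg (by positivity) (Finset.sum_nonneg fun p _ => hI p), fun f A hf h l => ?_⟩
    have hs : ContDiff ℝ ∞ (fun x => f x * θ x) := hf.mul hθ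
    have key := Real.pow_mul_norm_iteratedFDeriv_fourier_le (V := Eu n) (K := 0) (N := m)
      (f := fun x => f x * θ x) (hs.of_le (by exact_mod_cast le_top)) (by
        intro k p hk hp
        have hk0 : k = 0 := by simpa using hk
        have hp' : p ≤ m := by exact_mod_cast hp
        subst hk0
        simpa using h.integrable_iteratedFDeriv_mul hf hθ hint hp') (k := 0) (n := m)
      le_rfl le_rfl l
    rw [norm_iteratedFDeriv_zero] at key
    refine key.trans ?_
    simp only [pow_zero, one_mul, zero_add, Finset.range_one, Finset.singleton_product,
      Finset.sum_map, Function.Embedding.coeFn_mk, CharP.cast_eq_zero, mul_zero]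
    rw [mul_assoc, Finset.sum_mul]
    refine mul_le_mul_of_nonneg_left (Finset.sum_le_sum fun p hp => ?_) (by positivity)
    have hp' : p ≤ m := by have := Finset.mem_range.1 hp; omega
    rw [mul_comm, ← integral_const_mul]
    refine integral_mono (h.integrable_iteratedFDeriv_mul hf hθ hint hp') ?_ fun x =>
      h.norm_iteratedFDeriv_mul_le hf hθ hp' x
    exact (integrable_finsetSum _ fun i _ => (hint _).const_mul _).const_mul _
  obtain ⟨C0, hC0, h0⟩ := hcoord 0
  obtain ⟨C1, hC1, h1⟩ := hcoord (2 * M)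
  refine ⟨2 ^ (M - 1) * (C0 + C1), by positivity, fun f A hf h l => ?_⟩
  have a0 := h0 f A hf (h.mono (Nat.zero_le _)) l
  have a1 := h1 f A hf h l
  have hp : bracketSq l ^ M ≤ 2 ^ (M - 1) * (1 ^ M + (‖l‖ ^ 2) ^ M) :=
    add_pow_le zero_le_one (sq_nonneg _) M
  rw [one_pow, ← pow_mul] at hp
  rw [pow_zero, one_mul] at a0
  calc bracketSq l ^ M * ‖𝓕 (fun x => f x * θ x) l‖
      ≤ 2 ^ (M - 1) * (1 + ‖l‖ ^ (2 * M)) * ‖𝓕 (fun x => f x * θ x) l‖ := by gcongr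
    _ = 2 ^ (M - 1) * (‖𝓕 (fun x => f x * θ x) l‖ +
          ‖l‖ ^ (2 * M) * ‖𝓕 (fun x => f x * θ x) l‖) := by ring
    _ ≤ 2 ^ (M - 1) * (C0 * A + C1 * A) := by gcongr
    _ = 2 ^ (M - 1) * (C0 + C1) * A := by ring

/-! ### The oscillatory integral `∫ b(x, ξ) φ(x) e^{2πi x·ξ} dx` and its `L²` bound -/

theorem eLpNorm_two_sq {α F : Type*} [MeasurableSpace α] [NormedAddCommGroup F] (f : α → F)
    (μ : Measure α) : eLpNorm f 2 μ ^ 2 = ∫⁻ x, ‖f x‖ₑ ^ 2 ∂μ := by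
  have := eLpNorm_nnreal_pow_eq_lintegral (f := f) (μ := μ) (p := 2) (by norm_num)
  simpa using this

/-- The Cauchy–Schwarz inequality with weight `w`. -/
theorem lintegral_mul_sq_le {α : Type*} [MeasurableSpace α] {μ : Measure α} {w g : α → ℝ≥0∞}
    (hw : AEMeasurable w μ) (hg : AEMeasurable g μ) :
    (∫⁻ x, w x * g x ∂μ) ^ 2 ≤ (∫⁻ x, w x ∂μ) * ∫⁻ x, w x * g x ^ 2 ∂μ := by
  have h := ENNReal.lintegral_mul_le_Lp_mul_Lq μ Real.HolderConjugate.two_two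
    (f := fun x => w x ^ (1 / 2 : ℝ)) (g := fun x => w x ^ (1 / 2 : ℝ) * g x)
    (hw.pow_const _) ((hw.pow_const _).mul hg)
  have hsq : ∀ t : ℝ≥0∞, (t ^ (1 / 2 : ℝ)) ^ (2 : ℝ) = t := fun t => by
    rw [← ENNReal.rpow_mul]; norm_num
  have e1 : ∀ x, ((fun x => w x ^ (1 / 2 : ℝ)) * fun x => w x ^ (1 / 2 : ℝ) * g x) x =
      w x * g x := fun x => by
    simp only [Pi.mul_apply]
    rw [← mul_assoc, ← ENNReal.rpow_add_of_nonneg _ _ (by norm_num) (by norm_num)]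
    norm_num
  simp only [e1, ENNReal.mul_rpow_of_nonneg _ _ (zero_le_two), hsq] at h
  have h2 := pow_le_pow_left' h 2
  refine h2.trans (le_of_eq ?_)
  rw [mul_pow, ← ENNReal.rpow_natCast, ← ENNReal.rpow_natCast]
  push_cast
  rw [hsq, hsq]
  simp

/-- `ξ ↦ ∫ b(x, ξ) φ(x) e^{2πi x·ξ} dx`, whose Fourier transform is `Ψ_bᵗ φ`. -/
noncomputable def oscInt {n : ℕ} (b : Eu n × Eu n → ℂ) (φ : Eu n → ℂ) (ξ : Eu n) : ℂ :=
  ∫ x : Eu n, b (x, ξ) * φ x * expChar x ξ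

theorem norm_expChar {n : ℕ} (x ξ : Eu n) : ‖expChar x ξ‖ = 1 := by
  unfold expChar
  rw [Complex.norm_exp]
  simp

theorem expChar_add {n : ℕ} (x ξ η : Eu n) : expChar x (ξ + η) = expChar x ξ * expChar x η := by
  unfold expChar
  rw [← Complex.exp_add, inner_add_right]
  push_cast
  ring_nf

theorem expChar_comm {n : ℕ} (x ξ : Eu n) : expChar x ξ = expChar ξ x := by
  unfold expChar
  rw [real_inner_comm]

theorem continuous_expChar {n : ℕ} : Continuous fun p : Eu n × Eu n => expChar p.1 p.2 := by
  unfold expChar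
  fun_prop

theorem fourier_eq_integral_expChar {n : ℕ} (f : Eu n → ℂ) (ξ : Eu n) :
    𝓕 f ξ = ∫ x, f x * expChar x (-ξ) := by
  rw [Real.fourier_eq']
  refine integral_congr_ae (Filter.Eventually.of_forall fun x => ?_)
  simp only [smul_eq_mul]
  rw [mul_comm]
  unfold expChar
  congr 2
  rw [inner_neg_right]
  push_cast
  ring

theorem oscInt_eq_fourier {n : ℕ} (b : Eu n × Eu n → ℂ) (φ : Eu n → ℂ) (ξ : Eu n) :
    oscInt b φ ξ = 𝓕 (fun x => b (x, ξ) * φ x) (-ξ) := by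
  rw [fourier_eq_integral_expChar, neg_neg]
  rfl

theorem fourier_mul_expChar {n : ℕ} (f : Eu n → ℂ) (ξ l : Eu n) :
    𝓕 (fun x => f x * expChar x ξ) l = 𝓕 f (l - ξ) := by
  simp only [fourier_eq_integral_expChar]
  refine integral_congr_ae (Filter.Eventually.of_forall fun x => ?_)
  simp only
  rw [mul_assoc, ← expChar_add]
  congr 2
  abel

theorem integral_fourier_mul_eq_of_integrable {n : ℕ} {f g : Eu n → ℂ} (hf : Integrable f)
    (hg : Integrable g) : ∫ ξ, 𝓕 f ξ * g ξ = ∫ x, f x * 𝓕 g x := by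
  simpa using! VectorFourier.integral_bilin_fourierIntegral_eq_flip (.mul ℂ ℂ) (L := innerₗ (Eu n))
    Real.continuous_fourierChar continuous_inner hf hg

/-- Plancherel's identity for a Schwartz function, in terms of `eLpNorm`. -/
theorem eLpNorm_fourier_schwartz {n : ℕ} (φ : 𝓢(Eu n, ℂ)) :
    eLpNorm (𝓕 (φ : Eu n → ℂ)) 2 volume = eLpNorm φ 2 volume := by
  have h := SchwartzMap.norm_fourier_toL2_eq φ
  rw [SchwartzMap.norm_toLp, SchwartzMap.norm_toLp,
    ENNReal.toReal_eq_toReal_iff' (SchwartzMap.eLpNorm_lt_top _ _ _).ne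
      (SchwartzMap.eLpNorm_lt_top _ _ _).ne] at h
  rwa [SchwartzMap.fourier_coe] at h

theorem hasTemperateGrowth_bracketSq_pow {n : ℕ} (k : ℕ) :
    Function.HasTemperateGrowth fun x : Eu n => bracketSq x ^ k :=
  ((Function.HasTemperateGrowth.const 1).add
    (Function.hasTemperateGrowth_norm_sq (Eu n))).pow k

/-- Multiplication by `(1 + |x|²)ᵏ` on Schwartz functions. -/
noncomputable def mulBracket {n : ℕ} (k : ℕ) (φ : 𝓢(Eu n, ℂ)) : 𝓢(Eu n, ℂ) :=
  SchwartzMap.smulLeftCLM ℂ (fun x : Eu n => bracketSq x ^ k) φ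

theorem mulBracket_apply {n : ℕ} (k : ℕ) (φ : 𝓢(Eu n, ℂ)) (x : Eu n) :
    mulBracket k φ x = (bracketSq x ^ k) • φ x :=
  SchwartzMap.smulLeftCLM_apply_apply (hasTemperateGrowth_bracketSq_pow k) φ x

/-- The fixed integrable weight `(1 + |x|²)⁻⁽ⁿ⁺¹⁾`, as a complex function. -/
noncomputable def decayWeight {n : ℕ} (x : Eu n) : ℂ := (((bracketSq x ^ (n + 1))⁻¹ : ℝ) : ℂ)

theorem contDiff_decayWeight {n : ℕ} : ContDiff ℝ ∞ (decayWeight (n := n)) :=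
  Complex.ofRealCLM.contDiff.comp (contDiff_inv_bracketSq_pow (n + 1))

theorem integrable_iteratedFDeriv_decayWeight {n : ℕ} (i : ℕ) :
    Integrable fun x => ‖iteratedFDeriv ℝ i (decayWeight (n := n)) x‖ := by
  obtain ⟨C, hC, h⟩ := exists_norm_iteratedFDeriv_inv_bracketSq_pow_le (V := Eu n) i (n + 1)
  refine Integrable.mono' ((integrable_inv_bracketSq_pow (n := n) (k := n + 1)
    (by omega)).const_mul C) ?_ ?_
  · exact (contDiff_decayWeight.continuous_iteratedFDeriv
      (by exact_mod_cast le_top)).norm.aestronglyMeasurable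
  · refine Filter.Eventually.of_forall fun x => ?_
    rw [norm_norm]
    refine le_trans (le_of_eq ?_) (h x)
    exact Complex.ofRealLI.norm_iteratedFDeriv_comp_left (n := ∞)
      (contDiff_inv_bracketSq_pow (n + 1)).contDiffAt (by exact_mod_cast le_top)

/-- Boundedness from a weighted `L²` space to `L²`. For fixed `ξ`, the function
`(1 + |x|²)⁻⁽ⁿ⁺¹⁾ b(x, ξ)` is a superposition of characters with integrable coefficients, so the
oscillatory integral is dominated by a convolution of an integrable function with the Fourier
transform of `(1 + |x|²)ⁿ⁺¹ φ`. -/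
theorem exists_eLpNorm_oscInt_le (n : ℕ) : ∃ C : ℝ, 0 ≤ C ∧
    ∀ (b : Eu n × Eu n → ℂ) (A : ℝ), ContDiff ℝ ∞ b → DerivBound (2 * (n + 1)) A b →
      ∀ φ : 𝓢(Eu n, ℂ), eLpNorm (oscInt b φ) 2 volume ≤
        ENNReal.ofReal (C * A) * eLpNorm (mulBracket (n + 1) φ) 2 volume := by
  obtain ⟨C, hC, h⟩ := exists_bracketSq_pow_mul_norm_fourier_le (contDiff_decayWeight (n := n))
    integrable_iteratedFDeriv_decayWeight (n + 1)
  set W : ℝ := ∫ x : Eu n, (bracketSq x ^ (n + 1))⁻¹ with hW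
  have hwint : Integrable fun x : Eu n => (bracketSq x ^ (n + 1))⁻¹ :=
    integrable_inv_bracketSq_pow (by omega)
  have hwpos : ∀ x : Eu n, 0 ≤ (bracketSq x ^ (n + 1))⁻¹ := fun x =>
    inv_nonneg.2 (pow_pos (bracketSq_pos x) _).le
  have hW0 : 0 ≤ W := integral_nonneg hwpos
  refine ⟨C * W, by positivity, fun b A hb hA φ => ?_⟩
  have hA0 := hA.nonneg
  set ψ := mulBracket (n + 1) φ with hψ
  let w : Eu n → ℝ≥0∞ := fun l => ENNReal.ofReal ((bracketSq l ^ (n + 1))⁻¹)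
  have hwm : Measurable w := by
    have : Continuous fun x : Eu n => (bracketSq x ^ (n + 1))⁻¹ :=
      (contDiff_inv_bracketSq_pow (r := 0) (n + 1)).continuous
    exact ENNReal.measurable_ofReal.comp this.measurable
  have hwW : ∫⁻ l, w l = ENNReal.ofReal W :=
    (ofReal_integral_eq_lintegral_ofReal hwint (Filter.Eventually.of_forall hwpos)).symm
  have hψm : Continuous (𝓕 (ψ : Eu n → ℂ)) := by
    rw [← SchwartzMap.fourier_coe]; exact (𝓕 ψ).continuous
  have hpt : ∀ ξ : Eu n, ‖oscInt b φ ξ‖ₑ ≤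
      ENNReal.ofReal (C * A) * ∫⁻ l, w l * ‖𝓕 (ψ : Eu n → ℂ) (l - ξ)‖ₑ := by
    intro ξ
    have hbs : ContDiff ℝ ∞ fun x => b (x, ξ) := hb.comp (contDiff_id.prodMk contDiff_const)
    let B : Eu n → ℂ := fun x => b (x, ξ) * decayWeight x
    have hBs : ContDiff ℝ ∞ B := hbs.mul contDiff_decayWeight
    have hBint : Integrable B := by
      have := (hA.slice hb ξ).integrable_iteratedFDeriv_mul hbs contDiff_decayWeight
        integrable_iteratedFDeriv_decayWeight (Nat.zero_le _)
      simp only [norm_iteratedFDeriv_zero] at this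
      exact (integrable_norm_iff hBs.continuous.aestronglyMeasurable).1 this
    -- The bound depends on `b` only through `A`, hence not on `ξ`.
    have hdecay : ∀ l, ‖𝓕 B l‖ ≤ C * A * (bracketSq l ^ (n + 1))⁻¹ := by
      intro l
      have := h (fun x => b (x, ξ)) A hbs (hA.slice hb ξ) l
      rw [← div_eq_mul_inv, le_div_iff₀ (pow_pos (bracketSq_pos l) _), mul_comm]
      exact this
    have hFc : Continuous (𝓕 B) :=
      VectorFourier.fourierIntegral_continuous Real.continuous_fourierChar
        (by exact continuous_inner) hBint
    have hFint : Integrable (𝓕 B) :=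
      Integrable.mono' (hwint.const_mul (C * A)) hFc.aestronglyMeasurable
        (Filter.Eventually.of_forall hdecay)
    have hGeq : 𝓕⁻ B = fun l => 𝓕 B (-l) := by
      funext l; exact Real.fourierInv_eq_fourier_neg B l
    have hGint : Integrable (𝓕⁻ B) := by rw [hGeq]; exact hFint.comp_neg
    have hinv : 𝓕 (𝓕⁻ B) = B := by
      funext x
      exact hBint.fourier_fourierInv_eq hFint hBs.continuous.continuousAt
    have hψe : Integrable fun x => ψ x * expChar x ξ := by
      refine (ψ.integrable (μ := volume)).mono ?_ (Filter.Eventually.of_forall fun x => ?_)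
      · exact (ψ.continuous.mul (continuous_expChar.comp
          (continuous_id.prodMk continuous_const))).aestronglyMeasurable
      · rw [norm_mul, norm_expChar, mul_one]
    have e1 : oscInt b φ ξ = ∫ l, 𝓕⁻ B l * 𝓕 (ψ : Eu n → ℂ) (l - ξ) := by
      calc oscInt b φ ξ = ∫ x, B x * (ψ x * expChar x ξ) := by
            refine integral_congr_ae (Filter.Eventually.of_forall fun x => ?_)
            have hne : (bracketSq x : ℂ) ≠ 0 := by exact_mod_cast (bracketSq_pos x).ne'
            simp only [B, hψ, mulBracket_apply, decayWeight, Complex.real_smul]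
            push_cast
            field_simp
        _ = ∫ x, 𝓕 (𝓕⁻ B) x * (ψ x * expChar x ξ) := by rw [hinv]
        _ = _ := by
            rw [integral_fourier_mul_eq_of_integrable hGint hψe]
            simp only [fourier_mul_expChar]
    rw [e1]
    refine (enorm_integral_le_lintegral_enorm _).trans ?_
    rw [← lintegral_const_mul' _ _ ENNReal.ofReal_ne_top]
    refine lintegral_mono fun l => ?_
    rw [enorm_mul, ← mul_assoc]
    refine mul_le_mul_left ?_ _
    rw [← ENNReal.ofReal_mul (by positivity), hGeq, ← ofReal_norm]
    refine ENNReal.ofReal_le_ofReal ((hdecay (-l)).trans ?_)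
    rw [bracketSq_neg]
  have hsq : eLpNorm (oscInt b φ) 2 volume ^ 2 ≤
      (ENNReal.ofReal (C * W * A) * eLpNorm ψ 2 volume) ^ 2 := by
    rw [eLpNorm_two_sq]
    have hm1 : Measurable fun p : Eu n × Eu n => ‖𝓕 (ψ : Eu n → ℂ) (p.2 - p.1)‖ₑ :=
      (hψm.comp (continuous_snd.sub continuous_fst)).enorm.measurable
    calc ∫⁻ ξ, ‖oscInt b φ ξ‖ₑ ^ 2
        ≤ ∫⁻ ξ, ENNReal.ofReal (C * A) ^ 2 * (ENNReal.ofReal W *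
            ∫⁻ l, w l * ‖𝓕 (ψ : Eu n → ℂ) (l - ξ)‖ₑ ^ 2) := by
          refine lintegral_mono fun ξ => ?_
          refine (pow_le_pow_left' (hpt ξ) 2).trans ?_
          rw [mul_pow, ← hwW]
          refine mul_le_mul_right (lintegral_mul_sq_le hwm.aemeasurable ?_) _
          exact (hψm.comp (continuous_id.sub continuous_const)).enorm.measurable.aemeasurable
      _ = ENNReal.ofReal (C * A) ^ 2 * (ENNReal.ofReal W *
            ∫⁻ ξ, ∫⁻ l, w l * ‖𝓕 (ψ : Eu n → ℂ) (l - ξ)‖ₑ ^ 2) := by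
          rw [lintegral_const_mul' _ _ (by finiteness),
            lintegral_const_mul' _ _ ENNReal.ofReal_ne_top]
      _ = ENNReal.ofReal (C * A) ^ 2 * (ENNReal.ofReal W *
            ∫⁻ l, w l * ∫⁻ ξ, ‖𝓕 (ψ : Eu n → ℂ) (l - ξ)‖ₑ ^ 2) := by
          rw [lintegral_lintegral_swap]
          · congr 3
            funext l
            rw [lintegral_const_mul' _ _ ENNReal.ofReal_ne_top]
          · exact ((hwm.comp measurable_snd).mul (hm1.pow_const 2)).aemeasurable
      _ = ENNReal.ofReal (C * A) ^ 2 * (ENNReal.ofReal W *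
            ∫⁻ l, w l * eLpNorm ψ 2 volume ^ 2) := by
          congr 3
          funext l
          rw [← eLpNorm_fourier_schwartz, eLpNorm_two_sq]
          congr 1
          exact lintegral_sub_left_eq_self (fun ξ => ‖𝓕 (ψ : Eu n → ℂ) ξ‖ₑ ^ 2) l
      _ = (ENNReal.ofReal (C * W * A) * eLpNorm ψ 2 volume) ^ 2 := by
          rw [lintegral_mul_const _ hwm, hwW, show C * W * A = C * A * W by ring,
            ENNReal.ofReal_mul (by positivity : 0 ≤ C * A)]
          ring
  exact (ENNReal.pow_le_pow_left_iff (by norm_num)).1 hsq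

/-! ### The transpose maps Schwartz functions to Schwartz functions -/

/-- The `j`-th coordinate as a complex-valued real linear form on `ℝⁿ`. -/
noncomputable def coordForm {n : ℕ} (j : Fin n) : Eu n →L[ℝ] ℂ :=
  Complex.ofRealCLM.comp (EuclideanSpace.proj j)

theorem coordForm_apply {n : ℕ} (j : Fin n) (x : Eu n) : coordForm j x = (x j : ℂ) := rfl

theorem hasTemperateGrowth_coord {n : ℕ} (j : Fin n) :
    Function.HasTemperateGrowth fun x : Eu n => x j :=
  (EuclideanSpace.proj j : Eu n →L[ℝ] ℝ).hasTemperateGrowth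

/-- Multiplication by the coordinate `x_j` on Schwartz functions. -/
noncomputable def mulCoord {n : ℕ} (j : Fin n) (φ : 𝓢(Eu n, ℂ)) : 𝓢(Eu n, ℂ) :=
  SchwartzMap.smulLeftCLM ℂ (fun x : Eu n => x j) φ

theorem mulCoord_apply {n : ℕ} (j : Fin n) (φ : 𝓢(Eu n, ℂ)) (x : Eu n) :
    mulCoord j φ x = x j • φ x :=
  SchwartzMap.smulLeftCLM_apply_apply (hasTemperateGrowth_coord j) φ x

theorem DerivBound.partialXi {n N : ℕ} {A : ℝ} {b : Eu n × Eu n → ℂ} (hb : ContDiff ℝ ∞ b)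
    (h : DerivBound (N + 1) A b) (j : Fin n) : DerivBound N A (partialXi j b) := by
  intro k hk p
  have hd : ContDiff ℝ ∞ (fderiv ℝ b) := hb.fderiv_right (m := ∞) (by norm_cast)
  refine (norm_iteratedFDeriv_clm_apply_const (f := fderiv ℝ b) hd.contDiffAt
    (by exact_mod_cast le_top)).trans ?_
  rw [norm_iteratedFDeriv_fderiv]
  refine (mul_le_of_le_one_left (norm_nonneg _) ?_).trans (h (k + 1) (by omega) p)
  simp [Prod.norm_def]

theorem contDiff_partialXi {n : ℕ} {b : Eu n × Eu n → ℂ} (hb : ContDiff ℝ ∞ b) (j : Fin n) :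
    ContDiff ℝ ∞ (partialXi j b) :=
  (dirDeriv (coordDir (.inr j)) ⟨b, hb⟩).2

theorem IsBddSymbol.partialXi {n : ℕ} {b : Eu n × Eu n → ℂ} (hb : IsBddSymbol b) (j : Fin n) :
    IsBddSymbol (partialXi j b) := by
  refine ⟨contDiff_partialXi hb.1 j, fun N => ?_⟩
  obtain ⟨A, hA⟩ := hb.2 (N + 1)
  exact ⟨A, hA.partialXi hb.1 j⟩

theorem IsBddSymbol.exists_norm_le {n : ℕ} {b : Eu n × Eu n → ℂ} (hb : IsBddSymbol b) :
    ∃ A : ℝ, 0 ≤ A ∧ ∀ p, ‖b p‖ ≤ A := by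
  obtain ⟨A, hA⟩ := hb.2 0
  exact ⟨A, hA.nonneg, fun p => by simpa using hA 0 le_rfl p⟩

theorem IsBddSymbol.integrable_oscInt {n : ℕ} {b : Eu n × Eu n → ℂ} (hb : IsBddSymbol b)
    (φ : 𝓢(Eu n, ℂ)) (ξ : Eu n) : Integrable fun x => b (x, ξ) * φ x * expChar x ξ := by
  obtain ⟨A, hA, h⟩ := hb.exists_norm_le
  refine Integrable.mono' ((φ.integrable (μ := volume)).norm.const_mul A) ?_
    (Filter.Eventually.of_forall fun x => ?_)
  · have h1 : Continuous fun x => b (x, ξ) :=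
      hb.1.continuous.comp (continuous_id.prodMk continuous_const)
    have h2 : Continuous fun x => expChar x ξ :=
      continuous_expChar.comp (continuous_id.prodMk continuous_const)
    exact ((h1.mul φ.continuous).mul h2).aestronglyMeasurable
  · rw [norm_mul, norm_mul, norm_expChar, mul_one]
    exact mul_le_mul_of_nonneg_right (h _) (norm_nonneg _)

/-- Scalar multiples of a fixed linear form, as a continuous linear map of the scalar. -/
noncomputable def smulForm {n : ℕ} (c : Eu n →L[ℝ] ℂ) : ℂ →L[ℝ] (Eu n →L[ℝ] ℂ) :=
  (ContinuousLinearMap.toSpanSingleton ℂ c).restrictScalars ℝ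

theorem smulForm_apply_apply {n : ℕ} (c : Eu n →L[ℝ] ℂ) (z : ℂ) (v : Eu n) :
    smulForm c z v = z * c v := rfl

/-- The `ξ`-derivative of the integrand of `oscInt b φ`. -/
noncomputable def oscDeriv {n : ℕ} (b : Eu n × Eu n → ℂ) (φ : 𝓢(Eu n, ℂ)) (ξ x : Eu n) :
    Eu n →L[ℝ] ℂ :=
  ∑ j, smulForm (coordForm j) (partialXi j b (x, ξ) * φ x * expChar x ξ +
      2 * Real.pi * Complex.I * (b (x, ξ) * mulCoord j φ x * expChar x ξ))

theorem hasFDerivAt_oscDeriv {n : ℕ} {b : Eu n × Eu n → ℂ} (hb : ContDiff ℝ ∞ b)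
    (φ : 𝓢(Eu n, ℂ)) (ξ x : Eu n) :
    HasFDerivAt (fun ξ => b (x, ξ) * φ x * expChar x ξ) (oscDeriv b φ ξ x) ξ := by
  have hb1 : HasFDerivAt (fun ξ => b (x, ξ))
      ((fderiv ℝ b (x, ξ)).comp (ContinuousLinearMap.inr ℝ (Eu n) (Eu n))) ξ :=
    ((hb.differentiable (by simp)) (x, ξ)).hasFDerivAt.comp ξ (hasFDerivAt_prodMk_right x ξ)
  have he0 : HasFDerivAt (fun ξ : Eu n => 2 * Real.pi * Complex.I * ((inner ℝ x ξ : ℝ) : ℂ))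
      ((2 * Real.pi * Complex.I) • (Complex.ofRealCLM.comp (innerSL ℝ x))) ξ :=
    ((Complex.ofRealCLM.comp (innerSL ℝ x)).hasFDerivAt).const_mul _
  have he := he0.cexp
  have hprod := (hb1.mul_const (φ x)).mul he
  refine hprod.congr_fderiv ?_
  ext v
  have hv : v = ∑ j, v j • EuclideanSpace.single j (1 : ℝ) := by
    simpa using ((EuclideanSpace.basisFun (Fin n) ℝ).sum_repr v).symm
  have hd : fderiv ℝ b (x, ξ) (0, v) = ∑ j, (v j : ℂ) * partialXi j b (x, ξ) := by
    conv_lhs => rw [hv]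
    have : ((0, ∑ j, v j • EuclideanSpace.single j (1 : ℝ)) : Eu n × Eu n) =
        ∑ j, v j • coordDir (.inr j) := by
      ext <;> simp [coordDir, Prod.fst_sum, Prod.snd_sum]
    rw [this, map_sum]
    refine Finset.sum_congr rfl fun j _ => ?_
    rw [map_smul, Complex.real_smul]
    rfl
  have hi : ((inner ℝ x v : ℝ) : ℂ) = ∑ j, (v j : ℂ) * (x j : ℂ) := by
    rw [PiLp.inner_apply]
    push_cast
    simp
  simp only [oscDeriv, sum_apply, add_apply, smul_apply, smul_eq_mul, smulForm_apply_apply,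
    coordForm_apply, ContinuousLinearMap.comp_apply, ContinuousLinearMap.inr_apply, hd,
    innerSL_apply_apply,
    Complex.ofRealCLM_apply, hi, mulCoord_apply, Complex.real_smul]
  change b (x, ξ) * φ x * (expChar x ξ * _) + expChar x ξ * _ = _
  simp only [Finset.mul_sum, ← Finset.sum_add_distrib]
  refine Finset.sum_congr rfl fun j _ => ?_
  ring

theorem norm_oscDeriv_le {n : ℕ} {b : Eu n × Eu n → ℂ} (φ : 𝓢(Eu n, ℂ)) {A0 : ℝ}
    {A1 : Fin n → ℝ} (h0 : ∀ p, ‖b p‖ ≤ A0) (h1 : ∀ j p, ‖partialXi j b p‖ ≤ A1 j) (ξ x : Eu n) :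
    ‖oscDeriv b φ ξ x‖ ≤ ∑ j, (A1 j * ‖φ x‖ + 2 * Real.pi * (A0 * ‖mulCoord j φ x‖)) *
      ‖smulForm (coordForm (n := n) j)‖ := by
  refine (norm_sum_le _ _).trans (Finset.sum_le_sum fun j _ => ?_)
  refine ((smulForm _).le_opNorm _).trans ?_
  rw [mul_comm]
  refine mul_le_mul_of_nonneg_right ((norm_add_le _ _).trans (add_le_add ?_ ?_)) (norm_nonneg _)
  · rw [norm_mul, norm_mul, norm_expChar, mul_one]
    exact mul_le_mul_of_nonneg_right (h1 j _) (norm_nonneg _)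
  · have hpi : ‖(2 * Real.pi * Complex.I : ℂ)‖ = 2 * Real.pi := by
      simp [abs_of_pos Real.pi_pos]
    rw [norm_mul, norm_mul _ (expChar x ξ), norm_mul (b (x, ξ)), norm_expChar, mul_one, hpi]
    exact mul_le_mul_of_nonneg_left (mul_le_mul_of_nonneg_right (h0 _) (norm_nonneg _))
      Real.two_pi_pos.le

/-- A version of `integrable_finsetSum` for normed groups, where unification is cheap. -/
theorem integrable_sum_of_normed {V G ι : Type*} [MeasurableSpace V] {μ : Measure V}
    [NormedAddCommGroup G] (s : Finset ι) {f : ι → V → G} (h : ∀ j ∈ s, Integrable (f j) μ) :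
    Integrable (fun x => ∑ j ∈ s, f j x) μ :=
  integrable_finsetSum s h

theorem IsBddSymbol.integrable_oscDeriv {n : ℕ} {b : Eu n × Eu n → ℂ} (hb : IsBddSymbol b)
    (φ : 𝓢(Eu n, ℂ)) (ξ : Eu n) : Integrable (oscDeriv b φ ξ) ∧
      ∫ x, oscDeriv b φ ξ x = ∑ j, smulForm (coordForm j) (oscInt (_root_.partialXi j b) φ ξ +
        2 * Real.pi * Complex.I * oscInt b (mulCoord j φ) ξ) := by
  have h1 : ∀ j, Integrable fun x => _root_.partialXi j b (x, ξ) * φ x * expChar x ξ := fun j =>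
    (hb.partialXi j).integrable_oscInt φ ξ
  have h2 : ∀ j, Integrable fun x =>
      2 * Real.pi * Complex.I * (b (x, ξ) * mulCoord j φ x * expChar x ξ) := fun j =>
    (hb.integrable_oscInt (mulCoord j φ) ξ).const_mul _
  have hint : ∀ j ∈ Finset.univ, Integrable fun x =>
      smulForm (coordForm j) (_root_.partialXi j b (x, ξ) * φ x * expChar x ξ +
        2 * Real.pi * Complex.I * (b (x, ξ) * mulCoord j φ x * expChar x ξ)) := fun j _ =>
    (smulForm (coordForm j)).integrable_comp ((h1 j).add (h2 j))
  have e : oscDeriv b φ ξ = fun x => ∑ j, smulForm (coordForm j)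
      (_root_.partialXi j b (x, ξ) * φ x * expChar x ξ +
        2 * Real.pi * Complex.I * (b (x, ξ) * mulCoord j φ x * expChar x ξ)) := rfl
  rw [e]
  constructor
  · exact integrable_sum_of_normed _ hint
  rw [integral_finsetSum _ hint]
  refine Finset.sum_congr rfl fun j _ => ?_
  refine ((smulForm (coordForm j)).integral_comp_comm ((h1 j).add (h2 j))).trans
    (congrArg (smulForm (coordForm j)) ?_)
  refine (integral_add (h1 j) (h2 j)).trans ?_
  rw [integral_const_mul]
  rfl

/-- The `ξ`-derivative of the oscillatory integral falls on the symbol or produces a factor `x_j`;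
both terms are again oscillatory integrals of the same kind. -/
theorem IsBddSymbol.hasFDerivAt_oscInt {n : ℕ} {b : Eu n × Eu n → ℂ} (hb : IsBddSymbol b)
    (φ : 𝓢(Eu n, ℂ)) (ξ : Eu n) :
    HasFDerivAt (oscInt b φ) (∑ j, smulForm (coordForm j) (oscInt (_root_.partialXi j b) φ ξ +
      2 * Real.pi * Complex.I * oscInt b (mulCoord j φ) ξ)) ξ := by
  rw [← (hb.integrable_oscDeriv φ ξ).2]
  obtain ⟨A0, hA0, h0⟩ := hb.exists_norm_le
  choose A1 hA1 h1 using fun j => (hb.partialXi j).exists_norm_le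
  have hbound : Integrable fun x => ∑ j, (A1 j * ‖φ x‖ +
      2 * Real.pi * (A0 * ‖mulCoord j φ x‖)) * ‖smulForm (coordForm (n := n) j)‖ := by
    refine integrable_finsetSum _ fun j _ => ?_
    have i1 : Integrable fun x => ‖φ x‖ := (φ.integrable (μ := volume)).norm
    have i2 : Integrable fun x => ‖mulCoord j φ x‖ :=
      ((mulCoord j φ).integrable (μ := volume)).norm
    exact ((i1.const_mul _).add ((i2.const_mul _).const_mul _)).mul_const _
  exact hasFDerivAt_integral_of_dominated_of_fderiv_le (s := Set.univ) Filter.univ_mem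
    (Filter.Eventually.of_forall fun ξ => (hb.integrable_oscInt φ ξ).aestronglyMeasurable)
    (hb.integrable_oscInt φ ξ) (hb.integrable_oscDeriv φ ξ).1.aestronglyMeasurable
    (Filter.Eventually.of_forall fun x ξ _ => norm_oscDeriv_le φ h0 h1 ξ x) hbound
    (Filter.Eventually.of_forall fun x ξ _ => hasFDerivAt_oscDeriv hb.1 φ ξ x)

theorem IsBddSymbol.exists_pow_mul_norm_oscInt_le {n : ℕ} {b : Eu n × Eu n → ℂ}
    (hb : IsBddSymbol b) (φ : 𝓢(Eu n, ℂ)) (k : ℕ) :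
    ∃ C : ℝ, ∀ ξ, ‖ξ‖ ^ k * ‖oscInt b φ ξ‖ ≤ C := by
  obtain ⟨C, -, h⟩ := exists_bracketSq_pow_mul_norm_fourier_le (φ.smooth ⊤)
    (fun i => by simpa using φ.integrable_pow_mul_iteratedFDeriv volume 0 i) k
  obtain ⟨A, hA⟩ := hb.2 (2 * k)
  refine ⟨C * A, fun ξ => ?_⟩
  have hbs : ContDiff ℝ ∞ fun x => b (x, ξ) := hb.1.comp (contDiff_id.prodMk contDiff_const)
  have := h _ A hbs (hA.slice hb.1 ξ) (-ξ)
  rw [← oscInt_eq_fourier, bracketSq_neg] at this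
  refine le_trans (mul_le_mul_of_nonneg_right (pow_le_pow_left₀ (norm_nonneg _) ?_ k)
    (norm_nonneg _)) this
  unfold bracketSq
  nlinarith [sq_nonneg (‖ξ‖ - 1)]

theorem IsBddSymbol.fderiv_oscInt {n : ℕ} {b : Eu n × Eu n → ℂ} (hb : IsBddSymbol b)
    (φ : 𝓢(Eu n, ℂ)) : fderiv ℝ (oscInt b φ) = fun ξ => ∑ j,
      (smulForm (coordForm j) (oscInt (_root_.partialXi j b) φ ξ) +
        smulForm ((2 * Real.pi * Complex.I) • coordForm j) (oscInt b (mulCoord j φ) ξ)) := by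
  funext ξ
  rw [(hb.hasFDerivAt_oscInt φ ξ).fderiv]
  refine Finset.sum_congr rfl fun j _ => ?_
  ext v
  simp only [add_apply, smulForm_apply_apply, smul_apply, smul_eq_mul]
  ring

theorem IsBddSymbol.contDiff_oscInt {n : ℕ} (m : ℕ) : ∀ {b : Eu n × Eu n → ℂ},
    IsBddSymbol b → ∀ φ : 𝓢(Eu n, ℂ), ContDiff ℝ m (oscInt b φ) := by
  induction m with
  | zero =>
    intro b hb φ
    have : Differentiable ℝ (oscInt b φ) := fun ξ => (hb.hasFDerivAt_oscInt φ ξ).differentiableAt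
    exact contDiff_zero.2 this.continuous
  | succ m ih =>
    intro b hb φ
    have h : ContDiff ℝ ((m : WithTop ℕ∞) + 1) (oscInt b φ) := by
      rw [contDiff_succ_iff_fderiv]
      refine ⟨fun ξ => (hb.hasFDerivAt_oscInt φ ξ).differentiableAt, by simp, ?_⟩
      rw [hb.fderiv_oscInt φ]
      refine ContDiff.sum fun j _ => ?_
      exact ((smulForm _).contDiff.comp (ih (hb.partialXi j) φ)).add
        ((smulForm _).contDiff.comp (ih hb (mulCoord j φ)))
    exact_mod_cast h

theorem IsBddSymbol.exists_pow_mul_norm_iteratedFDeriv_oscInt_le {n : ℕ} (m k : ℕ) :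
    ∀ {b : Eu n × Eu n → ℂ}, IsBddSymbol b → ∀ φ : 𝓢(Eu n, ℂ),
      ∃ C : ℝ, ∀ ξ, ‖ξ‖ ^ k * ‖iteratedFDeriv ℝ m (oscInt b φ) ξ‖ ≤ C := by
  induction m with
  | zero =>
    intro b hb φ
    simpa using hb.exists_pow_mul_norm_oscInt_le φ k
  | succ m ih =>
    intro b hb φ
    choose C1 h1 using fun j => ih (hb.partialXi j) φ
    choose C2 h2 using fun j => ih hb (mulCoord j φ)
    refine ⟨∑ j, (‖smulForm (coordForm (n := n) j)‖ * C1 j +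
      ‖smulForm ((2 * Real.pi * Complex.I) • coordForm (n := n) j)‖ * C2 j), fun ξ => ?_⟩
    have hs1 : ∀ j, ContDiff ℝ m fun ξ =>
        smulForm (coordForm j) (oscInt (_root_.partialXi j b) φ ξ) := fun j =>
      (smulForm _).contDiff.comp (contDiff_oscInt m (hb.partialXi j) φ)
    have hs2 : ∀ j, ContDiff ℝ m fun ξ =>
        smulForm ((2 * Real.pi * Complex.I) • coordForm j) (oscInt b (mulCoord j φ) ξ) := fun j =>
      (smulForm _).contDiff.comp (contDiff_oscInt m hb (mulCoord j φ))
    rw [← norm_iteratedFDeriv_fderiv, hb.fderiv_oscInt φ,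
      iteratedFDeriv_sum (fun j _ => (hs1 j).add (hs2 j))]
    rw [show ∀ F : Fin n → (Eu n → (Eu n) [×m]→L[ℝ] (Eu n →L[ℝ] ℂ)),
      (∑ j, F j) ξ = ∑ j, F j ξ from fun F => Finset.sum_apply _ _ _]
    refine (mul_le_mul_of_nonneg_left (norm_sum_le _ _) (by positivity)).trans ?_
    rw [Finset.mul_sum]
    refine Finset.sum_le_sum fun j _ => ?_
    have e : iteratedFDeriv ℝ m (fun ξ =>
        smulForm (coordForm j) (oscInt (_root_.partialXi j b) φ ξ) +
        smulForm ((2 * Real.pi * Complex.I) • coordForm j) (oscInt b (mulCoord j φ) ξ)) ξ = _ :=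
      iteratedFDeriv_add_apply (hs1 j).contDiffAt (hs2 j).contDiffAt
    rw [e]
    have b1 := (smulForm (coordForm (n := n) j)).norm_iteratedFDeriv_comp_left (n := m) (x := ξ)
      (N := m) (contDiff_oscInt m (hb.partialXi j) φ).contDiffAt le_rfl
    have b2 := (smulForm ((2 * Real.pi * Complex.I) •
      coordForm (n := n) j)).norm_iteratedFDeriv_comp_left (n := m) (x := ξ)
      (N := m) (contDiff_oscInt m hb (mulCoord j φ)).contDiffAt le_rfl
    calc ‖ξ‖ ^ k * ‖_ + _‖
        ≤ ‖ξ‖ ^ k * (‖smulForm (coordForm (n := n) j)‖ *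
              ‖iteratedFDeriv ℝ m (oscInt (_root_.partialXi j b) φ) ξ‖ +
            ‖smulForm ((2 * Real.pi * Complex.I) • coordForm (n := n) j)‖ *
              ‖iteratedFDeriv ℝ m (oscInt b (mulCoord j φ)) ξ‖) :=
          mul_le_mul_of_nonneg_left ((norm_add_le _ _).trans (add_le_add b1 b2)) (by positivity)
      _ = ‖smulForm (coordForm (n := n) j)‖ *
              (‖ξ‖ ^ k * ‖iteratedFDeriv ℝ m (oscInt (_root_.partialXi j b) φ) ξ‖) +
            ‖smulForm ((2 * Real.pi * Complex.I) • coordForm (n := n) j)‖ *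
              (‖ξ‖ ^ k * ‖iteratedFDeriv ℝ m (oscInt b (mulCoord j φ)) ξ‖) := by ring
      _ ≤ _ := by
          gcongr
          · exact h1 j ξ
          · exact h2 j ξ

/-- The oscillatory integral of a Schwartz function against a symbol with bounded derivatives,
as a Schwartz function of `ξ`. -/
noncomputable def oscSchwartz {n : ℕ} (b : Eu n × Eu n → ℂ) (hb : IsBddSymbol b)
    (φ : 𝓢(Eu n, ℂ)) : 𝓢(Eu n, ℂ) where
  toFun := oscInt b φ
  smooth' := contDiff_infty.2 fun m => IsBddSymbol.contDiff_oscInt m hb φ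
  decay' k m := IsBddSymbol.exists_pow_mul_norm_iteratedFDeriv_oscInt_le m k hb φ

theorem coe_oscSchwartz {n : ℕ} {b : Eu n × Eu n → ℂ} (hb : IsBddSymbol b)
    (φ : 𝓢(Eu n, ℂ)) : (oscSchwartz b hb φ : Eu n → ℂ) = oscInt b φ := rfl

/-- The transpose `Ψ_bᵗ` as a map of Schwartz functions. -/
noncomputable def transposeSchwartz {n : ℕ} (b : Eu n × Eu n → ℂ) (hb : IsBddSymbol b)
    (φ : 𝓢(Eu n, ℂ)) : 𝓢(Eu n, ℂ) :=
  𝓕 (oscSchwartz b hb φ)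

theorem coe_transposeSchwartz {n : ℕ} {b : Eu n × Eu n → ℂ} (hb : IsBddSymbol b)
    (φ : 𝓢(Eu n, ℂ)) : (transposeSchwartz b hb φ : Eu n → ℂ) = psiTranspose b φ := rfl

/-! ### Weighted `L²` bounds for the transpose -/

/-- Multiplying `Ψ_bᵗ φ` by `y_j` either multiplies `φ` by `x_j` or differentiates the symbol. -/
theorem coord_mul_transposeSchwartz {n : ℕ} {b : Eu n × Eu n → ℂ} (hb : IsBddSymbol b)
    (φ : 𝓢(Eu n, ℂ)) (j : Fin n) (y : Eu n) :
    (y j : ℂ) * transposeSchwartz b hb φ y = transposeSchwartz b hb (mulCoord j φ) y +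
      (2 * Real.pi * Complex.I)⁻¹ * transposeSchwartz (partialXi j b) (hb.partialXi j) φ y := by
  have hne : (2 * Real.pi * Complex.I : ℂ) ≠ 0 := by
    simp [Real.pi_ne_zero]
  have hd : LineDeriv.lineDerivOp (EuclideanSpace.single j (1 : ℝ)) (oscSchwartz b hb φ) =
      oscSchwartz (partialXi j b) (hb.partialXi j) φ +
        (2 * Real.pi * Complex.I : ℂ) • oscSchwartz b hb (mulCoord j φ) := by
    ext ξ
    rw [SchwartzMap.lineDerivOp_apply_eq_fderiv, coe_oscSchwartz,
      (hb.hasFDerivAt_oscInt φ ξ).fderiv]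
    simp only [sum_apply, smulForm_apply_apply, coordForm_apply]
    rw [Finset.sum_eq_single j]
    · simp [coe_oscSchwartz]
    · intro i _ hij
      simp [hij]
    · simp
  have hF := congrArg (fun S : 𝓢(Eu n, ℂ) => (𝓕 S) y) hd
  rw [SchwartzMap.fourier_lineDerivOp_eq, FourierTransform.fourier_add,
    FourierTransform.fourier_smul] at hF
  have htg : Function.HasTemperateGrowth
      fun x : Eu n => inner ℝ x (EuclideanSpace.single j (1 : ℝ)) :=
    Function.hasTemperateGrowth_inner_left _
  simp only [smul_apply, add_apply, smul_eq_mul, SchwartzMap.smulLeftCLM_apply_apply htg,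
    Complex.real_smul] at hF
  have hin : inner ℝ y (EuclideanSpace.single j (1 : ℝ)) = y j := by
    rw [EuclideanSpace.inner_single_right]; simp
  rw [hin] at hF
  unfold transposeSchwartz
  field_simp
  linear_combination hF

theorem abs_coord_le_bracketSq {n : ℕ} (x : Eu n) (j : Fin n) : |x j| ≤ bracketSq x := by
  have h := PiLp.norm_apply_le x j
  rw [Real.norm_eq_abs] at h
  unfold bracketSq
  nlinarith [sq_nonneg (‖x‖ - 1)]

/-- Decay of `Ψ_bᵗ φ` in one coordinate direction, in the `L²` sense. -/
theorem exists_eLpNorm_coord_pow_mul_transpose_le (n L : ℕ) : ∃ C : ℝ, 0 ≤ C ∧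
    ∀ (b : Eu n × Eu n → ℂ) (hb : IsBddSymbol b) (A : ℝ), DerivBound (2 * (n + 1) + L) A b →
      ∀ (φ : 𝓢(Eu n, ℂ)) (j : Fin n),
        eLpNorm (fun y => (y j : ℂ) ^ L * transposeSchwartz b hb φ y) 2 volume ≤
          ENNReal.ofReal (C * A) * eLpNorm (mulBracket (n + 1 + L) φ) 2 volume := by
  induction L with
  | zero =>
    obtain ⟨C, hC, h⟩ := exists_eLpNorm_oscInt_le n
    refine ⟨C, hC, fun b hb A hA φ j => ?_⟩
    simp only [pow_zero, one_mul, add_zero]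
    refine le_trans (le_of_eq ?_) (h b A hb.1 hA φ)
    exact eLpNorm_fourier_schwartz (oscSchwartz b hb φ)
  | succ L ih =>
    obtain ⟨C, hC, h⟩ := ih
    refine ⟨C + C, by positivity, fun b hb A hA φ j => ?_⟩
    have hA0 := hA.nonneg
    have hmeas : ∀ (S : 𝓢(Eu n, ℂ)) (c : ℂ),
        AEStronglyMeasurable (fun y => c * ((y j : ℂ) ^ L * S y)) := fun S c => by
      have : Continuous fun y : Eu n => (y j : ℂ) := (coordForm j).continuous
      exact (continuous_const.mul ((this.pow L).mul S.continuous)).aestronglyMeasurable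
    have hmul1 : eLpNorm (mulBracket (n + 1 + L) (mulCoord j φ)) 2 volume ≤
        eLpNorm (mulBracket (n + 1 + (L + 1)) φ) 2 volume := by
      refine eLpNorm_mono fun x => ?_
      rw [mulBracket_apply, mulBracket_apply, mulCoord_apply, norm_smul, norm_smul, norm_smul,
        ← mul_assoc]
      refine mul_le_mul_of_nonneg_right ?_ (norm_nonneg _)
      have hp := (bracketSq_pos x).le
      rw [← add_assoc, pow_succ, norm_mul, Real.norm_of_nonneg hp]
      exact mul_le_mul_of_nonneg_left (abs_coord_le_bracketSq x j) (norm_nonneg _)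
    have hmul2 : eLpNorm (mulBracket (n + 1 + L) φ) 2 volume ≤
        eLpNorm (mulBracket (n + 1 + (L + 1)) φ) 2 volume := by
      refine eLpNorm_mono fun x => ?_
      rw [mulBracket_apply, mulBracket_apply, norm_smul, norm_smul]
      refine mul_le_mul_of_nonneg_right ?_ (norm_nonneg _)
      have hp := (bracketSq_pos x).le
      rw [Real.norm_of_nonneg (by positivity), Real.norm_of_nonneg (by positivity)]
      exact pow_le_pow_right₀ (one_le_bracketSq x) (by omega)
    have hc : ‖((2 * Real.pi * Complex.I)⁻¹ : ℂ)‖ₑ ≤ 1 := by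
      rw [← ofReal_norm, ← ENNReal.ofReal_one]
      refine ENNReal.ofReal_le_ofReal ?_
      rw [norm_inv]
      refine inv_le_one_of_one_le₀ ?_
      simp only [norm_mul, Complex.norm_ofNat, Complex.norm_real, Complex.norm_I, mul_one,
        Real.norm_of_nonneg Real.pi_pos.le]
      linarith [Real.pi_gt_three]
    calc eLpNorm (fun y => (y j : ℂ) ^ (L + 1) * transposeSchwartz b hb φ y) 2 volume
        = eLpNorm ((fun y => 1 * ((y j : ℂ) ^ L * transposeSchwartz b hb (mulCoord j φ) y)) +
            fun y => (2 * Real.pi * Complex.I)⁻¹ *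
              ((y j : ℂ) ^ L * transposeSchwartz (partialXi j b) (hb.partialXi j) φ y))
              2 volume := by
          congr 1
          funext y
          rw [pow_succ, mul_assoc, coord_mul_transposeSchwartz, Pi.add_apply]
          ring
      _ ≤ ‖(1 : ℂ)‖ₑ * (ENNReal.ofReal (C * A) *
            eLpNorm (mulBracket (n + 1 + (L + 1)) φ) 2 volume) + 1 * (ENNReal.ofReal (C * A) *
            eLpNorm (mulBracket (n + 1 + (L + 1)) φ) 2 volume) := by
          refine (eLpNorm_add_le (hmeas _ _) (hmeas _ _) (by norm_num)).trans (add_le_add ?_ ?_)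
          · refine (eLpNorm_const_smul_le (c := (1 : ℂ))).trans ?_
            exact mul_le_mul_right ((h b hb A (hA.mono (by omega)) _ j).trans
              (mul_le_mul_right hmul1 _)) _
          · refine (eLpNorm_const_smul_le (c := ((2 * Real.pi * Complex.I)⁻¹ : ℂ))).trans ?_
            exact mul_le_mul' hc ((h _ (hb.partialXi j) A (hA.partialXi hb.1 j) _ j).trans
              (mul_le_mul_right hmul2 _))
      _ = _ := by
          rw [add_mul C, ENNReal.ofReal_add (by positivity) (by positivity)]
          simp
          ring

theorem exists_bracketSq_pow_le_sum (n L : ℕ) : ∃ C : ℝ, 0 ≤ C ∧ ∀ y : Eu n,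
    bracketSq y ^ L ≤ C * (1 + ∑ j, (y j) ^ (2 * L)) := by
  have key : ∀ s : Finset (Fin n), ∃ C : ℝ, 0 ≤ C ∧ ∀ y : Eu n,
      (1 + ∑ j ∈ s, (y j) ^ 2) ^ L ≤ C * (1 + ∑ j ∈ s, (y j) ^ (2 * L)) := by
    intro s
    induction s using Finset.induction_on with
    | empty => exact ⟨1, zero_le_one, fun y => by simp⟩
    | insert i s hi ih =>
      obtain ⟨C, hC, h⟩ := ih
      refine ⟨2 ^ (L - 1) * (C + 1), by positivity, fun y => ?_⟩
      have hs : 0 ≤ ∑ j ∈ s, (y j) ^ (2 * L) := Finset.sum_nonneg fun j _ => by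
        rw [pow_mul]; positivity
      have hi2 : (y i ^ 2) ^ L = y i ^ (2 * L) := (pow_mul _ _ _).symm
      have hi0 : 0 ≤ y i ^ (2 * L) := by rw [pow_mul]; positivity
      rw [Finset.sum_insert hi, Finset.sum_insert hi, ← add_assoc, add_right_comm]
      refine (add_pow_le (by positivity) (sq_nonneg (y i)) L).trans ?_
      rw [mul_assoc, hi2]
      refine mul_le_mul_of_nonneg_left ?_ (by positivity)
      nlinarith [h y]
  obtain ⟨C, hC, h⟩ := key Finset.univ
  refine ⟨C, hC, fun y => ?_⟩
  have : bracketSq y = 1 + ∑ j, (y j) ^ 2 := by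
    unfold bracketSq
    rw [EuclideanSpace.norm_sq_eq]
    simp
  rw [this]
  exact h y

/-- Decay of `Ψ_bᵗ φ` in all directions: `(1 + |y|²)ᴸ` is dominated by the powers `1` and
`|y_j|²ᴸ`. -/
theorem exists_eLpNorm_bracketSq_pow_smul_transpose_le (n L : ℕ) : ∃ C : ℝ, 0 ≤ C ∧
    ∀ (b : Eu n × Eu n → ℂ) (hb : IsBddSymbol b) (A : ℝ),
      DerivBound (2 * (n + 1) + 2 * L) A b → ∀ φ : 𝓢(Eu n, ℂ),
        eLpNorm (fun y => (bracketSq y ^ L) • transposeSchwartz b hb φ y) 2 volume ≤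
          ENNReal.ofReal (C * A) * eLpNorm (mulBracket (n + 1 + 2 * L) φ) 2 volume := by
  obtain ⟨C0, hC0, h0⟩ := exists_eLpNorm_oscInt_le n
  obtain ⟨C1, hC1, h1⟩ := exists_eLpNorm_coord_pow_mul_transpose_le n (2 * L)
  obtain ⟨C2, hC2, h2⟩ := exists_bracketSq_pow_le_sum n L
  refine ⟨C2 * (C0 + n * C1), by positivity, fun b hb A hA φ => ?_⟩
  have hA0 := hA.nonneg
  set T := transposeSchwartz b hb φ with hT
  set G : Eu n → ℝ := fun y => ‖T y‖ with hG
  set H : Fin n → Eu n → ℝ := fun j y => ‖(y j : ℂ) ^ (2 * L) * T y‖ with hH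
  have hGm : AEStronglyMeasurable G := T.continuous.norm.aestronglyMeasurable
  have hHm : ∀ j ∈ Finset.univ, AEStronglyMeasurable (H j) := fun j _ => by
    have : Continuous fun y : Eu n => (y j : ℂ) := (coordForm j).continuous
    exact ((this.pow _).mul T.continuous).norm.aestronglyMeasurable
  have hmul : eLpNorm (mulBracket (n + 1) φ) 2 volume ≤
      eLpNorm (mulBracket (n + 1 + 2 * L) φ) 2 volume := by
    refine eLpNorm_mono fun x => ?_
    rw [mulBracket_apply, mulBracket_apply, norm_smul, norm_smul]
    refine mul_le_mul_of_nonneg_right ?_ (norm_nonneg _)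
    have hp := (bracketSq_pos x).le
    rw [Real.norm_of_nonneg (by positivity), Real.norm_of_nonneg (by positivity)]
    exact pow_le_pow_right₀ (one_le_bracketSq x) (by omega)
  have hpt : ∀ y, ‖(bracketSq y ^ L) • T y‖ ≤ (C2 • (G + ∑ j, H j)) y := by
    intro y
    have hp := (bracketSq_pos y).le
    rw [norm_smul, Real.norm_of_nonneg (by positivity)]
    refine (mul_le_mul_of_nonneg_right (h2 y) (norm_nonneg _)).trans (le_of_eq ?_)
    simp only [Pi.smul_apply, Pi.add_apply, Finset.sum_apply, hG, hH, norm_mul, norm_pow,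
      Complex.norm_real, smul_eq_mul, ← Finset.sum_mul]
    have : ∀ j, ‖y j‖ ^ (2 * L) = y j ^ (2 * L) := fun j => by
      rw [pow_mul, pow_mul, Real.norm_eq_abs, sq_abs]
    simp only [this]
    ring
  calc eLpNorm (fun y => (bracketSq y ^ L) • T y) 2 volume
      ≤ eLpNorm (C2 • (G + ∑ j, H j)) 2 volume := eLpNorm_mono_real hpt
    _ ≤ ‖C2‖ₑ * (eLpNorm G 2 volume + ∑ j, eLpNorm (H j) 2 volume) := by
        refine (eLpNorm_const_smul_le).trans (mul_le_mul_right ?_ _)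
        refine (eLpNorm_add_le hGm (Finset.aestronglyMeasurable_sum _ hHm)
          (by norm_num)).trans ?_
        exact add_le_add le_rfl (eLpNorm_sum_le hHm (by norm_num))
    _ ≤ ENNReal.ofReal C2 * (ENNReal.ofReal (C0 * A) *
          eLpNorm (mulBracket (n + 1 + 2 * L) φ) 2 volume +
          ∑ _j : Fin n, ENNReal.ofReal (C1 * A) *
            eLpNorm (mulBracket (n + 1 + 2 * L) φ) 2 volume) := by
        rw [Real.enorm_of_nonneg hC2]
        refine mul_le_mul_right (add_le_add ?_ (Finset.sum_le_sum fun j _ => ?_)) _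
        · rw [hG, eLpNorm_norm]
          refine le_trans (le_of_eq (eLpNorm_fourier_schwartz (oscSchwartz b hb φ))) ?_
          exact (h0 b A hb.1 (hA.mono (by omega)) φ).trans (mul_le_mul_right hmul _)
        · simp only [hH]
          rw [eLpNorm_norm]
          exact h1 b hb A hA φ j
    _ = _ := by
        rw [Finset.sum_const, Finset.card_univ, Fintype.card_fin, nsmul_eq_mul,
          show C2 * (C0 + n * C1) * A = C2 * (C0 * A + n * (C1 * A)) by ring,
          ENNReal.ofReal_mul hC2, ENNReal.ofReal_add (by positivity) (by positivity),
          ENNReal.ofReal_mul (p := (n : ℝ)) (by positivity), ENNReal.ofReal_natCast]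
        ring

/-- The symbol `a(x + s, ξ)`. -/
def translateSymbol {n : ℕ} (s : Eu n) (a : Eu n × Eu n → ℂ) : Eu n × Eu n → ℂ :=
  fun p => a (p.1 + s, p.2)

theorem translateSymbol_eq {n : ℕ} (s : Eu n) (a : Eu n × Eu n → ℂ) :
    translateSymbol s a = fun p => a (p + (s, 0)) := by
  funext p
  simp only [translateSymbol, Prod.add_def, add_zero]

theorem DerivBound.translateSymbol {n N : ℕ} {A : ℝ} {a : Eu n × Eu n → ℂ}
    (h : DerivBound N A a) (s : Eu n) : DerivBound N A (translateSymbol s a) := by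
  intro k hk p
  rw [translateSymbol_eq, iteratedFDeriv_comp_add_right]
  exact h k hk _

theorem IsBddSymbol.translateSymbol {n : ℕ} {a : Eu n × Eu n → ℂ} (ha : IsBddSymbol a)
    (s : Eu n) : IsBddSymbol (translateSymbol s a) := by
  refine ⟨?_, fun N => ?_⟩
  · rw [translateSymbol_eq]
    exact ha.1.comp (contDiff_id.add contDiff_const)
  · obtain ⟨A, hA⟩ := ha.2 N
    exact ⟨A, hA.translateSymbol s⟩

/-- The Schwartz function `φ(x + s)`. -/
noncomputable def translateSchwartz {n : ℕ} (s : Eu n) (φ : 𝓢(Eu n, ℂ)) : 𝓢(Eu n, ℂ) :=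
  SchwartzMap.compSubConstCLM ℂ (-s) φ

theorem translateSchwartz_apply {n : ℕ} (s : Eu n) (φ : 𝓢(Eu n, ℂ)) (x : Eu n) :
    translateSchwartz s φ x = φ (x + s) := by
  simp [translateSchwartz]

theorem expChar_add_left {n : ℕ} (x y ξ : Eu n) :
    expChar (x + y) ξ = expChar x ξ * expChar y ξ := by
  rw [expChar_comm, expChar_add, expChar_comm ξ, expChar_comm ξ]

/-- Pseudo-differential operators are covariant under translations. -/
theorem psiTranspose_add {n : ℕ} (a : Eu n × Eu n → ℂ) (φ : 𝓢(Eu n, ℂ)) (s y : Eu n) :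
    psiTranspose a φ (y + s) = psiTranspose (translateSymbol s a) (translateSchwartz s φ) y := by
  change 𝓕 (oscInt a φ) (y + s) =
    𝓕 (oscInt (translateSymbol s a) (translateSchwartz s φ)) y
  rw [fourier_eq_integral_expChar, fourier_eq_integral_expChar]
  refine integral_congr_ae (Filter.Eventually.of_forall fun ξ => ?_)
  simp only
  have e : oscInt a φ ξ =
      expChar s ξ * oscInt (translateSymbol s a) (translateSchwartz s φ) ξ := by
    unfold oscInt
    rw [← integral_const_mul, ← integral_add_right_eq_self _ s]
    refine integral_congr_ae (Filter.Eventually.of_forall fun x => ?_)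
    simp only [translateSymbol, translateSchwartz_apply, expChar_add_left]
    ring
  have e2 : expChar s ξ * expChar ξ (-s) = 1 := by
    rw [expChar_comm s, ← expChar_add, add_neg_cancel]
    simp [expChar]
  rw [e, neg_add, expChar_add]
  linear_combination (oscInt (translateSymbol s a) (translateSchwartz s φ) ξ *
    expChar ξ (-y)) * e2

/-- The weighted `L²` bound for the transpose, uniformly over the centre `s` of the weights. -/
theorem exists_eLpNorm_bracketSq_sub_pow_smul_psiTranspose_le (n L : ℕ) : ∃ C : ℝ, 0 ≤ C ∧
    ∀ (a : Eu n × Eu n → ℂ), IsBddSymbol a → ∀ A : ℝ,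
      DerivBound (2 * (n + 1) + 2 * L) A a → ∀ (s : Eu n) (φ : 𝓢(Eu n, ℂ)),
        eLpNorm (fun y => (bracketSq (y - s) ^ L) • psiTranspose a φ y) 2 volume ≤
          ENNReal.ofReal (C * A) *
            eLpNorm (fun x => (bracketSq (x - s) ^ (n + 1 + 2 * L)) • φ x) 2 volume := by
  obtain ⟨C, hC, h⟩ := exists_eLpNorm_bracketSq_pow_smul_transpose_le n L
  refine ⟨C, hC, fun a ha A hA s φ => ?_⟩
  have key := h _ (ha.translateSymbol s) A (hA.translateSymbol s) (translateSchwartz s φ)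
  have hbc : ∀ k : ℕ, Continuous fun x : Eu n => bracketSq (x - s) ^ k := fun k =>
    ((contDiff_bracketSq (r := 0)).continuous.comp (continuous_id.sub continuous_const)).pow k
  have hmp := measurePreserving_add_right (volume : Measure (Eu n)) s
  have m1 : AEStronglyMeasurable
      (fun y => (bracketSq (y - s) ^ L) • psiTranspose a φ y) volume := by
    rw [← coe_transposeSchwartz ha]
    exact ((hbc L).smul (transposeSchwartz a ha φ).continuous).aestronglyMeasurable
  have m2 : AEStronglyMeasurable
      (fun x => (bracketSq (x - s) ^ (n + 1 + 2 * L)) • φ x) volume :=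
    ((hbc _).smul φ.continuous).aestronglyMeasurable
  rw [← eLpNorm_comp_measurePreserving m1 hmp, ← eLpNorm_comp_measurePreserving m2 hmp]
  convert key using 3
  · simp only [Function.comp_apply, add_sub_cancel_right, psiTranspose_add,
      coe_transposeSchwartz]
  · funext x
    simp only [Function.comp_apply, add_sub_cancel_right, mulBracket_apply,
      translateSchwartz_apply]

/-! ### Duality: existence, uniqueness and local bounds of `Ψ_a f` -/

/-- A linear functional that is bounded through a linear map into a Hilbert space is represented by
a vector of that space (Hahn–Banach followed by Riesz). -/
theorem exists_inner_eq_of_norm_le {V H : Type*} [AddCommGroup V] [Module ℂ V]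
    [NormedAddCommGroup H] [InnerProductSpace ℂ H] [CompleteSpace H] (J : V →ₗ[ℂ] H)
    (ℓ : V →ₗ[ℂ] ℂ) {C : ℝ} (hC : 0 ≤ C) (h : ∀ v, ‖ℓ v‖ ≤ C * ‖J v‖) :
    ∃ u : H, ‖u‖ ≤ C ∧ ∀ v, ℓ v = inner ℂ u (J v) := by
  have hker : LinearMap.ker J ≤ LinearMap.ker ℓ := by
    intro v hv
    rw [LinearMap.mem_ker] at hv ⊢
    have := h v
    rw [hv, norm_zero, mul_zero] at this
    exact norm_le_zero_iff.1 this
  let f : LinearMap.range J →ₗ[ℂ] ℂ :=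
    ((LinearMap.ker J).liftQ ℓ hker).comp J.quotKerEquivRange.symm.toLinearMap
  have hf : ∀ v, f ⟨J v, LinearMap.mem_range_self J v⟩ = ℓ v := by
    intro v
    simp only [f, LinearMap.comp_apply, LinearEquiv.coe_coe,
      LinearMap.quotKerEquivRange_symm_apply_image]
    exact Submodule.liftQ_apply _ _ _
  have hfb : ∀ x, ‖f x‖ ≤ C * ‖x‖ := by
    rintro ⟨x, v, rfl⟩
    rw [hf]
    exact h v
  obtain ⟨F, hF, hFn⟩ := exists_extension_norm_eq (LinearMap.range J) (f.mkContinuous C hfb)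
  refine ⟨(InnerProductSpace.toDual ℂ H).symm F, ?_, fun v => ?_⟩
  · rw [LinearIsometryEquiv.norm_map, hFn]
    exact LinearMap.mkContinuous_norm_le _ hC _
  · rw [InnerProductSpace.toDual_symm_apply, ← hf v]
    exact (hF ⟨J v, LinearMap.mem_range_self J v⟩).symm

/-- A functional on Schwartz functions bounded by a weighted `L²` norm is given by an `L²`
function against the weight. -/
theorem exists_memLp_of_norm_le_mulBracket {n : ℕ} (k : ℕ) (ℓ : 𝓢(Eu n, ℂ) →ₗ[ℂ] ℂ) {C : ℝ≥0∞}
    (hC : C ≠ ⊤) (h : ∀ φ, ‖ℓ φ‖ₑ ≤ C * eLpNorm (mulBracket k φ) 2 volume) :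
    ∃ u : Eu n → ℂ, MemLp u 2 ∧ eLpNorm u 2 volume ≤ C ∧
      ∀ φ, ℓ φ = ∫ x, u x * mulBracket k φ x := by
  let J : 𝓢(Eu n, ℂ) →ₗ[ℂ] Lp ℂ 2 (volume : Measure (Eu n)) :=
    ((SchwartzMap.toLpCLM ℂ ℂ 2 volume).comp
      (SchwartzMap.smulLeftCLM ℂ (fun x : Eu n => ((bracketSq x ^ k : ℝ) : ℂ)))).toLinearMap
  have hJ : ∀ φ, J φ = (mulBracket k φ).toLp 2 := by
    intro φ
    change (SchwartzMap.smulLeftCLM ℂ (fun x : Eu n => ((bracketSq x ^ k : ℝ) : ℂ)) φ).toLp 2 = _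
    congr 1
    exact SchwartzMap.smulLeftCLM_ofReal ℂ (hasTemperateGrowth_bracketSq_pow k) φ
  obtain ⟨u, hu, hℓ⟩ := exists_inner_eq_of_norm_le J ℓ (C := C.toReal) ENNReal.toReal_nonneg (by
    intro φ
    rw [hJ, SchwartzMap.norm_toLp, ← ENNReal.toReal_mul, ← toReal_enorm]
    exact ENNReal.toReal_mono
      (ENNReal.mul_ne_top hC (SchwartzMap.eLpNorm_lt_top _ _ _).ne) (h φ))
  have hstar : eLpNorm (fun x => starRingEnd ℂ (u x)) 2 volume = eLpNorm u 2 volume :=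
    eLpNorm_congr_norm_ae (Filter.Eventually.of_forall fun x => by simp)
  refine ⟨fun x => starRingEnd ℂ (u x), ⟨?_, ?_⟩, ?_, fun φ => ?_⟩
  · exact Complex.continuous_conj.comp_aestronglyMeasurable (Lp.aestronglyMeasurable u)
  · rw [hstar]; exact Lp.eLpNorm_lt_top u
  · rw [hstar, ← ENNReal.ofReal_toReal hC, ← ENNReal.ofReal_toReal (Lp.eLpNorm_ne_top u)]
    exact ENNReal.ofReal_le_ofReal hu
  · rw [hℓ, hJ, L2.inner_def]
    refine integral_congr_ae ?_
    filter_upwards [SchwartzMap.coeFn_toLp (mulBracket k φ) 2 volume] with x hx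
    rw [hx, RCLike.inner_apply, mul_comm]

/-- Locally integrable functions with the same pairings against Schwartz functions agree. -/
theorem ae_eq_of_integral_schwartz_eq {n : ℕ} {u v : Eu n → ℂ} (hu : LocallyIntegrable u)
    (hv : LocallyIntegrable v) (h : ∀ φ : 𝓢(Eu n, ℂ), ∫ x, u x * φ x = ∫ x, v x * φ x) :
    u =ᵐ[volume] v := by
  refine ae_eq_of_integral_contDiff_smul_eq hu hv fun χ hχ hχc => ?_
  have hc : HasCompactSupport fun x => (χ x : ℂ) := hχc.comp_left Complex.ofReal_zero
  have hs : ContDiff ℝ ∞ fun x => (χ x : ℂ) := Complex.ofRealCLM.contDiff.comp hχ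
  have := h (hc.toSchwartzMap hs)
  simp only [HasCompactSupport.toSchwartzMap_toFun] at this
  simpa only [Complex.real_smul, mul_comm] using this

theorem lintegral_enorm_mul_le {α : Type*} [MeasurableSpace α] {μ : Measure α} {p q : α → ℂ}
    (hp : AEStronglyMeasurable p μ) (hq : AEStronglyMeasurable q μ) :
    ∫⁻ x, ‖p x * q x‖ₑ ∂μ ≤ eLpNorm p 2 μ * eLpNorm q 2 μ := by
  have h := eLpNorm_smul_le_mul_eLpNorm (p := 2) (q := 2) (r := 1) hq hp
  rw [eLpNorm_one_eq_lintegral_enorm] at h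
  exact h

theorem continuous_bracketSq_sub_pow {n : ℕ} (s : Eu n) (k : ℕ) :
    Continuous fun x : Eu n => bracketSq (x - s) ^ k :=
  ((contDiff_bracketSq (r := 0)).continuous.comp (continuous_id.sub continuous_const)).pow k

/-- The norm of `f` in `L²((1 + |y - s|²)⁻²ᴸ dy)`. -/
noncomputable def decayNorm {n : ℕ} (L : ℕ) (s : Eu n) (f : Eu n → ℂ) : ℝ≥0∞ :=
  eLpNorm (fun y => (bracketSq (y - s) ^ L)⁻¹ • f y) 2 volume

/-- The pairing of `f` with `Ψ_aᵗ φ` is bounded by dual weighted `L²` norms, uniformly in the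
centre of the weights. -/
theorem exists_lintegral_mul_psiTranspose_le (n L : ℕ) : ∃ C : ℝ, 0 ≤ C ∧
    ∀ (a : Eu n × Eu n → ℂ), IsBddSymbol a → ∀ A : ℝ,
      DerivBound (2 * (n + 1) + 2 * L) A a →
      ∀ f : Eu n → ℂ, AEStronglyMeasurable f volume → ∀ (s : Eu n) (φ : 𝓢(Eu n, ℂ)),
        ∫⁻ y, ‖f y * psiTranspose a φ y‖ₑ ≤ decayNorm L s f * (ENNReal.ofReal (C * A) *
          eLpNorm (fun x => (bracketSq (x - s) ^ (n + 1 + 2 * L)) • φ x) 2 volume) := by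
  obtain ⟨C, hC, h⟩ := exists_eLpNorm_bracketSq_sub_pow_smul_psiTranspose_le n L
  refine ⟨C, hC, fun a ha A hA f hf s φ => ?_⟩
  refine le_trans ?_ (mul_le_mul_right (h a ha A hA s φ) _)
  have hc := continuous_bracketSq_sub_pow s L
  have hne : ∀ y, bracketSq (y - s) ^ L ≠ 0 := fun y => (pow_pos (bracketSq_pos _) L).ne'
  refine le_trans (le_of_eq ?_) (lintegral_enorm_mul_le ?_ ?_)
  · refine lintegral_congr fun y => ?_
    rw [smul_mul_smul_comm, inv_mul_cancel₀ (hne y), one_smul]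
  · exact (hc.inv₀ hne).aestronglyMeasurable.smul hf
  · rw [← coe_transposeSchwartz ha]
    exact (hc.smul (transposeSchwartz a ha φ).continuous).aestronglyMeasurable

theorem oscSchwartz_add {n : ℕ} {b : Eu n × Eu n → ℂ} (hb : IsBddSymbol b) (φ ψ : 𝓢(Eu n, ℂ)) :
    oscSchwartz b hb (φ + ψ) = oscSchwartz b hb φ + oscSchwartz b hb ψ := by
  ext ξ
  change oscInt b (φ + ψ : 𝓢(Eu n, ℂ)) ξ = oscInt b φ ξ + oscInt b ψ ξ
  refine Eq.trans ?_ (integral_add (hb.integrable_oscInt φ ξ) (hb.integrable_oscInt ψ ξ))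
  refine integral_congr_ae (Filter.Eventually.of_forall fun x => ?_)
  simp only [add_apply]
  ring

theorem oscSchwartz_smul {n : ℕ} {b : Eu n × Eu n → ℂ} (hb : IsBddSymbol b) (c : ℂ)
    (φ : 𝓢(Eu n, ℂ)) : oscSchwartz b hb (c • φ) = c • oscSchwartz b hb φ := by
  ext ξ
  change oscInt b (c • φ : 𝓢(Eu n, ℂ)) ξ = c * oscInt b φ ξ
  refine Eq.trans ?_ (integral_const_mul c _)
  refine integral_congr_ae (Filter.Eventually.of_forall fun x => ?_)
  simp only [smul_apply, smul_eq_mul]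
  ring

/-- The transpose as a linear map of the Schwartz space. -/
noncomputable def transposeLM {n : ℕ} (b : Eu n × Eu n → ℂ) (hb : IsBddSymbol b) :
    𝓢(Eu n, ℂ) →ₗ[ℂ] 𝓢(Eu n, ℂ) where
  toFun := transposeSchwartz b hb
  map_add' φ ψ := by
    unfold transposeSchwartz; rw [oscSchwartz_add, FourierTransform.fourier_add]
  map_smul' c φ := by
    unfold transposeSchwartz; rw [oscSchwartz_smul, FourierTransform.fourier_smul, RingHom.id_apply]

/-- The linear functional `φ ↦ ∫ g T φ`, for a linear operator `T` on Schwartz functions. -/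
noncomputable def pairingLM {n : ℕ} (g : Eu n → ℂ) (T : 𝓢(Eu n, ℂ) →ₗ[ℂ] 𝓢(Eu n, ℂ))
    (h : ∀ φ, Integrable fun x => g x * T φ x) : 𝓢(Eu n, ℂ) →ₗ[ℂ] ℂ where
  toFun φ := ∫ x, g x * T φ x
  map_add' φ ψ := by
    rw [← integral_add (h φ) (h ψ)]
    refine integral_congr_ae (Filter.Eventually.of_forall fun x => ?_)
    simp only [map_add, add_apply, mul_add]
  map_smul' c φ := by
    rw [RingHom.id_apply, smul_eq_mul, ← integral_const_mul]
    refine integral_congr_ae (Filter.Eventually.of_forall fun x => ?_)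
    simp only [map_smul, smul_apply, smul_eq_mul]
    ring

theorem IsBddSymbol.integrable_mul_psiTranspose {n L : ℕ} {a : Eu n × Eu n → ℂ}
    (ha : IsBddSymbol a) {f : Eu n → ℂ} (hf : AEStronglyMeasurable f volume) {s : Eu n}
    (hfL : decayNorm L s f < ⊤) (φ : 𝓢(Eu n, ℂ)) :
    Integrable fun y => f y * psiTranspose a φ y := by
  obtain ⟨C, hC, h⟩ := exists_lintegral_mul_psiTranspose_le n L
  obtain ⟨A, hA⟩ := ha.2 (2 * (n + 1) + 2 * L)
  rw [← coe_transposeSchwartz ha]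
  refine ⟨hf.mul (transposeSchwartz a ha φ).continuous.aestronglyMeasurable, ?_⟩
  refine (h a ha A hA f hf s φ).trans_lt (ENNReal.mul_lt_top hfL
    (ENNReal.mul_lt_top ENNReal.ofReal_lt_top ?_))
  have e : (fun x => (bracketSq (x - s) ^ (n + 1 + 2 * L)) • φ x) =
      (mulBracket (n + 1 + 2 * L) (translateSchwartz s φ)) ∘ fun x => x + -s := by
    funext x
    simp [mulBracket_apply, translateSchwartz_apply, sub_eq_add_neg]
  rw [e, eLpNorm_comp_measurePreserving
    (mulBracket (n + 1 + 2 * L) (translateSchwartz s φ)).continuous.aestronglyMeasurable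
    (measurePreserving_add_right volume (-s))]
  exact SchwartzMap.eLpNorm_lt_top _ _ _

/-- If `f` has polynomial growth in the `L²` sense, the distribution `Ψ_a f` is a function. -/
theorem IsBddSymbol.exists_isPsiOf {n L : ℕ} {a : Eu n × Eu n → ℂ} (ha : IsBddSymbol a)
    {f : Eu n → ℂ} (hf : AEStronglyMeasurable f volume) (hfL : decayNorm L 0 f < ⊤) :
    ∃ g : Eu n → ℂ, IsPsiOf a f g := by
  obtain ⟨C, hC, h⟩ := exists_lintegral_mul_psiTranspose_le n L
  obtain ⟨A, hA⟩ := ha.2 (2 * (n + 1) + 2 * L)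
  have hint := fun φ => ha.integrable_mul_psiTranspose hf hfL φ
  set K := n + 1 + 2 * L with hK
  obtain ⟨u, hu, -, hrep⟩ := exists_memLp_of_norm_le_mulBracket K
    (pairingLM f (transposeLM a ha) hint) (C := decayNorm L 0 f * ENNReal.ofReal (C * A))
    (ENNReal.mul_ne_top hfL.ne ENNReal.ofReal_ne_top) (by
      intro φ
      refine (enorm_integral_le_lintegral_enorm _).trans ?_
      refine (h a ha A hA f hf 0 φ).trans (le_of_eq ?_)
      rw [mul_assoc]
      congr 3
      funext x
      rw [sub_zero, mulBracket_apply])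
  have hbc : Continuous fun x : Eu n => ((bracketSq x ^ K : ℝ) : ℂ) :=
    Complex.continuous_ofReal.comp ((contDiff_bracketSq (r := 0)).continuous.pow K)
  have e : ∀ (φ : 𝓢(Eu n, ℂ)) (x : Eu n),
      u x * ((bracketSq x ^ K : ℝ) : ℂ) * φ x = u x * mulBracket K φ x := by
    intro φ x
    rw [mulBracket_apply, Complex.real_smul, mul_assoc]
  refine ⟨fun x => u x * ((bracketSq x ^ K : ℝ) : ℂ), ?_, fun φ => ⟨hint φ, ?_, ?_⟩⟩
  · exact (hu.locallyIntegrable (by norm_num)).mul_continuous hbc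
  · simp only [e]
    exact hu.integrable_mul ((mulBracket K φ).memLp 2)
  · simp only [e]
    exact (hrep φ).symm

/-- The local bound behind all the others: on balls of a fixed radius, `Ψ_a f` is controlled by
the `L²` norm of `f` with a weight of decay order `L` centred at the same point. The constant is
increased by one so that the estimate is trivial when the right-hand norm is infinite. -/
theorem exists_eLpNorm_ball_le_decayNorm (n L : ℕ) {R : ℝ} (hR : 0 < R) : ∃ C : ℝ, 0 ≤ C ∧
    ∀ (a : Eu n × Eu n → ℂ), IsBddSymbol a → ∀ A : ℝ,
      DerivBound (2 * (n + 1) + 2 * L) A a →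
      ∀ f g : Eu n → ℂ, AEStronglyMeasurable f volume → IsPsiOf a f g → ∀ s : Eu n,
        eLpNorm g 2 (volume.restrict (Metric.closedBall s R)) ≤
          ENNReal.ofReal (C * A + 1) * decayNorm L s f := by
  obtain ⟨C, hC, h⟩ := exists_lintegral_mul_psiTranspose_le n L
  set K := n + 1 + 2 * L with hK
  set B : ℝ := (1 + (R + 1) ^ 2) ^ K with hB
  have hB0 : 0 ≤ B := by positivity
  refine ⟨C * B, by positivity, fun a ha A hA f g hf hg s => ?_⟩
  have hA0 := hA.nonneg
  by_cases htop : decayNorm L s f = ⊤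
  · rw [htop, ENNReal.mul_top]
    · exact le_top
    · simp only [ne_eq, ENNReal.ofReal_eq_zero, not_le]
      positivity
  let χ : ContDiffBump s := ⟨R, R + 1, hR, by linarith⟩
  have hχs : ContDiff ℝ ∞ χ := χ.contDiff
  have hχt : Function.HasTemperateGrowth fun x => (χ x : ℂ) := by
    refine HasCompactSupport.hasTemperateGrowth ?_ (Complex.ofRealCLM.contDiff.comp hχs)
    exact χ.hasCompactSupport.comp_left Complex.ofReal_zero
  let T : 𝓢(Eu n, ℂ) →ₗ[ℂ] 𝓢(Eu n, ℂ) :=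
    (SchwartzMap.smulLeftCLM ℂ (fun x => (χ x : ℂ))).toLinearMap
  have hT : ∀ φ x, T φ x = (χ x : ℂ) * φ x := fun φ x =>
    SchwartzMap.smulLeftCLM_apply_apply hχt φ x
  have hTφ : ∀ φ, eLpNorm (fun x => (bracketSq (x - s) ^ K) • T φ x) 2 volume ≤
      ENNReal.ofReal B * eLpNorm (mulBracket 0 φ) 2 volume := by
    intro φ
    rw [← Real.enorm_of_nonneg hB0, ← eLpNorm_const_smul]
    refine eLpNorm_mono fun x => ?_
    have hb := bracketSq_pos (x - s)
    rw [Pi.smul_apply, norm_smul, norm_smul, hT, norm_mul, mulBracket_apply, pow_zero, one_smul,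
      ← mul_assoc, Real.norm_of_nonneg hB0, Real.norm_of_nonneg (by positivity),
      Complex.norm_real, Real.norm_of_nonneg χ.nonneg]
    refine mul_le_mul_of_nonneg_right ?_ (norm_nonneg _)
    by_cases hx : R + 1 ≤ dist x s
    · rw [χ.zero_of_le_dist hx, mul_zero]
      exact hB0
    · push Not at hx
      refine (mul_le_of_le_one_right (by positivity) χ.le_one).trans ?_
      refine pow_le_pow_left₀ hb.le ?_ K
      rw [dist_eq_norm] at hx
      unfold bracketSq
      have := pow_le_pow_left₀ (norm_nonneg _) hx.le 2
      linarith
  obtain ⟨u, hu, hun, hrep⟩ := exists_memLp_of_norm_le_mulBracket 0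
    (pairingLM g T fun φ => (hg.2 (T φ)).2.1)
    (C := decayNorm L s f * (ENNReal.ofReal (C * A) * ENNReal.ofReal B))
    (ENNReal.mul_ne_top htop (by finiteness)) (by
      intro φ
      change ‖∫ x, g x * T φ x‖ₑ ≤ _
      rw [(hg.2 (T φ)).2.2]
      refine (enorm_integral_le_lintegral_enorm _).trans ?_
      refine (h a ha A hA f hf s (T φ)).trans ?_
      rw [mul_assoc, mul_assoc]
      exact mul_le_mul_right (mul_le_mul_right (hTφ φ) _) _)
  have hae : u =ᵐ[volume] fun x => g x * (χ x : ℂ) := by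
    refine ae_eq_of_integral_schwartz_eq (hu.locallyIntegrable (by norm_num))
      (hg.1.mul_continuous (Complex.continuous_ofReal.comp χ.continuous)) fun φ => ?_
    calc ∫ x, u x * φ x = ∫ x, u x * mulBracket 0 φ x := by
          simp only [mulBracket_apply, pow_zero, one_smul]
      _ = ∫ x, g x * T φ x := (hrep φ).symm
      _ = _ := by simp only [hT, mul_assoc]
  calc eLpNorm g 2 (volume.restrict (Metric.closedBall s R))
      = eLpNorm (fun x => g x * (χ x : ℂ)) 2 (volume.restrict (Metric.closedBall s R)) := by
        refine eLpNorm_congr_ae ?_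
        refine (ae_restrict_iff' Metric.isClosed_closedBall.measurableSet).2
          (Filter.Eventually.of_forall fun x hx => ?_)
        change g x = g x * ((χ x : ℝ) : ℂ)
        rw [χ.one_of_mem_closedBall hx]
        simp
    _ ≤ eLpNorm (fun x => g x * (χ x : ℂ)) 2 volume :=
        eLpNorm_mono_measure _ Measure.restrict_le_self
    _ = eLpNorm u 2 volume := (eLpNorm_congr_ae hae).symm
    _ ≤ decayNorm L s f * (ENNReal.ofReal (C * A) * ENNReal.ofReal B) := hun
    _ ≤ ENNReal.ofReal (C * B * A + 1) * decayNorm L s f := by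
        rw [mul_comm, ← ENNReal.ofReal_mul (by positivity)]
        refine mul_le_mul_left (ENNReal.ofReal_le_ofReal ?_) _
        linarith [show C * A * B = C * B * A by ring]

/-! ### The operator on Schwartz functions -/

theorem IsBddSymbol.comp_swap {n : ℕ} {a : Eu n × Eu n → ℂ} (ha : IsBddSymbol a) :
    IsBddSymbol fun p : Eu n × Eu n => a (p.2, p.1) := by
  let σ : Eu n × Eu n →L[ℝ] Eu n × Eu n :=
    (ContinuousLinearMap.snd ℝ (Eu n) (Eu n)).prod (ContinuousLinearMap.fst ℝ (Eu n) (Eu n))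
  have hσ : ‖σ‖ ≤ 1 := by
    refine ContinuousLinearMap.opNorm_le_bound _ zero_le_one fun p => ?_
    rw [one_mul]
    exact le_of_eq (max_comm _ _)
  refine ⟨ha.1.comp σ.contDiff, fun N => ?_⟩
  obtain ⟨A, hA⟩ := ha.2 N
  refine ⟨A, fun k hk p => ?_⟩
  have e : (fun p : Eu n × Eu n => a (p.2, p.1)) = a ∘ σ := rfl
  rw [e, ContinuousLinearMap.iteratedFDeriv_comp_right _ ha.1 p (by exact_mod_cast le_top)]
  refine (ContinuousMultilinearMap.norm_compContinuousLinearMap_le _ _).trans ?_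
  refine (mul_le_of_le_one_right (norm_nonneg _) ?_).trans (hA k hk _)
  exact Finset.prod_le_one (fun _ _ => norm_nonneg _) fun _ _ => hσ

/-- Exchanging the roles of `x` and `ξ` turns `Ψ_a f` into an oscillatory integral of `f̂`, so it
is again a Schwartz function. -/
theorem psiOp_eq_oscSchwartz {n : ℕ} {a : Eu n × Eu n → ℂ} (ha : IsBddSymbol a)
    (f : 𝓢(Eu n, ℂ)) : psiOp a f = oscSchwartz _ ha.comp_swap (𝓕 f) := by
  funext x
  refine integral_congr_ae (Filter.Eventually.of_forall fun ξ => ?_)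
  simp only [SchwartzMap.fourier_coe, expChar_comm x ξ]

theorem integrable_schwartz_mul {n : ℕ} (φ ψ : 𝓢(Eu n, ℂ)) : Integrable fun x => φ x * ψ x :=
  (φ.memLp 2).integrable_mul (ψ.memLp 2)

theorem IsBddSymbol.isPsiOf_psiOp {n : ℕ} {a : Eu n × Eu n → ℂ} (ha : IsBddSymbol a)
    (f : 𝓢(Eu n, ℂ)) : IsPsiOf a f (psiOp a f) := by
  refine ⟨?_, fun φ => ⟨?_, ?_, ?_⟩⟩
  · rw [psiOp_eq_oscSchwartz ha]
    exact (SchwartzMap.continuous _).locallyIntegrable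
  · rw [← coe_transposeSchwartz ha]
    exact integrable_schwartz_mul _ _
  · rw [psiOp_eq_oscSchwartz ha]
    exact integrable_schwartz_mul _ _
  · obtain ⟨A, hA, hbd⟩ := ha.exists_norm_le
    have hI : Integrable (fun p : Eu n × Eu n =>
        (a p * expChar p.1 p.2) * (φ p.1 * (𝓕 f) p.2)) (volume.prod volume) := by
      refine Integrable.bdd_mul (c := A) ?_ ?_ (Filter.Eventually.of_forall fun p => ?_)
      · exact (φ.integrable (μ := volume)).mul_prod ((𝓕 f).integrable (μ := volume))
      · exact (ha.1.continuous.mul continuous_expChar).aestronglyMeasurable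
      · rw [norm_mul, norm_expChar, mul_one]
        exact hbd p
    calc ∫ x, psiOp a f x * φ x
        = ∫ x, ∫ ξ, (a (x, ξ) * expChar x ξ) * (φ x * (𝓕 f) ξ) := by
          refine integral_congr_ae (Filter.Eventually.of_forall fun x => ?_)
          simp only [psiOp]
          rw [← integral_mul_const]
          refine integral_congr_ae (Filter.Eventually.of_forall fun ξ => ?_)
          simp only [SchwartzMap.fourier_coe]
          ring
      _ = ∫ ξ, ∫ x, (a (x, ξ) * expChar x ξ) * (φ x * (𝓕 f) ξ) := integral_integral_swap hI
      _ = ∫ ξ, (𝓕 f) ξ * oscSchwartz a ha φ ξ := by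
          refine integral_congr_ae (Filter.Eventually.of_forall fun ξ => ?_)
          simp only [coe_oscSchwartz, oscInt]
          rw [← integral_const_mul]
          refine integral_congr_ae (Filter.Eventually.of_forall fun x => ?_)
          simp only
          ring
      _ = ∫ y, f y * (𝓕 (oscSchwartz a ha φ)) y := SchwartzMap.integral_fourier_mul_eq _ _
      _ = ∫ y, f y * psiTranspose a φ y := rfl

/-! ### Averaging over the centre of the weights -/

/-- Tonelli's theorem for `1_{|t - y| ≤ R}`. -/
theorem lintegral_mul_setLIntegral_closedBall {n : ℕ} {V F : Eu n → ℝ≥0∞} (hV : Measurable V)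
    (hF : AEMeasurable F) (R : ℝ) :
    ∫⁻ t, V t * ∫⁻ y in Metric.closedBall t R, F y =
      ∫⁻ y, F y * ∫⁻ t in Metric.closedBall y R, V t := by
  let S : Set (Eu n × Eu n) := {p | dist p.1 p.2 ≤ R}
  have hS : MeasurableSet S := (isClosed_le continuous_dist continuous_const).measurableSet
  let I : Eu n × Eu n → ℝ≥0∞ := S.indicator 1
  have hI : Measurable I := measurable_one.indicator hS
  have hI1 : ∀ t y, dist t y ≤ R → I (t, y) = 1 := fun t y h =>
    Set.indicator_of_mem (show (t, y) ∈ S from h) 1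
  have hI0 : ∀ t y, ¬ dist t y ≤ R → I (t, y) = 0 := fun t y h =>
    Set.indicator_of_notMem (show (t, y) ∉ S from h) 1
  have h1 : ∀ t y, (Metric.closedBall t R).indicator F y = F y * I (t, y) := by
    intro t y
    by_cases h : dist t y ≤ R
    · have hy : y ∈ Metric.closedBall t R := by rw [Metric.mem_closedBall, dist_comm]; exact h
      rw [Set.indicator_of_mem hy, hI1 t y h, mul_one]
    · have hy : y ∉ Metric.closedBall t R := by rw [Metric.mem_closedBall, dist_comm]; exact h
      rw [Set.indicator_of_notMem hy, hI0 t y h, mul_zero]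
  have h2 : ∀ t y, (Metric.closedBall y R).indicator V t = V t * I (t, y) := by
    intro t y
    by_cases h : dist t y ≤ R
    · have hy : t ∈ Metric.closedBall y R := h
      rw [Set.indicator_of_mem hy, hI1 t y h, mul_one]
    · have hy : t ∉ Metric.closedBall y R := h
      rw [Set.indicator_of_notMem hy, hI0 t y h, mul_zero]
  have hF2 : AEMeasurable (fun p : Eu n × Eu n => F p.2) (volume.prod volume) :=
    hF.comp_snd
  calc ∫⁻ t, V t * ∫⁻ y in Metric.closedBall t R, F y
      = ∫⁻ t, ∫⁻ y, V t * (F y * I (t, y)) := by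
        refine lintegral_congr fun t => ?_
        rw [← lintegral_indicator Metric.isClosed_closedBall.measurableSet]
        simp only [h1]
        rw [lintegral_const_mul'']
        exact hF.mul (hI.comp measurable_prodMk_left).aemeasurable
    _ = ∫⁻ y, ∫⁻ t, V t * (F y * I (t, y)) := by
        refine lintegral_lintegral_swap ?_
        exact (hV.comp measurable_fst).aemeasurable.mul (hF2.mul hI.aemeasurable)
    _ = ∫⁻ y, F y * ∫⁻ t in Metric.closedBall y R, V t := by
        refine lintegral_congr fun y => ?_
        rw [← lintegral_indicator Metric.isClosed_closedBall.measurableSet]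
        simp only [h2]
        have hm : Measurable fun t => V t * I (t, y) :=
          hV.mul (hI.comp measurable_prodMk_right)
        rw [← lintegral_const_mul _ hm]
        refine lintegral_congr fun t => ?_
        ring

theorem volume_closedBall_eq {n : ℕ} (x : Eu n) (R : ℝ) :
    volume (Metric.closedBall x R) = volume (Metric.closedBall (0 : Eu n) R) :=
  Measure.addHaar_closedBall_center _ _ _

/-- A weight that varies by at most a bounded factor over balls of radius `1` may be replaced by
its averages over such balls. -/
theorem lintegral_mul_le_lintegral_average {n : ℕ} {V F : Eu n → ℝ≥0∞} (hV : Measurable V)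
    (hF : AEMeasurable F) {D : ℝ≥0∞} (hD : D ≠ ⊤)
    (hVD : ∀ t y, dist t y ≤ 1 → V y ≤ D * V t) :
    volume (Metric.closedBall (0 : Eu n) 1) * ∫⁻ y, V y * F y ≤
      D * ∫⁻ t, V t * ∫⁻ y in Metric.closedBall t 1, F y := by
  have hv : volume (Metric.closedBall (0 : Eu n) 1) ≠ ⊤ := measure_closedBall_lt_top.ne
  rw [lintegral_mul_setLIntegral_closedBall hV hF, ← lintegral_const_mul' _ _ hD,
    ← lintegral_const_mul' _ _ hv]
  refine lintegral_mono fun y => ?_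
  have : V y * volume (Metric.closedBall (0 : Eu n) 1) ≤
      D * ∫⁻ t in Metric.closedBall y 1, V t := by
    rw [← lintegral_const_mul' _ _ hD, ← volume_closedBall_eq y, ← setLIntegral_const]
    exact setLIntegral_mono (hV.const_mul D) fun t ht => hVD t y (Metric.mem_closedBall.1 ht)
  calc volume (Metric.closedBall (0 : Eu n) 1) * (V y * F y)
      = F y * (V y * volume (Metric.closedBall (0 : Eu n) 1)) := by ring
    _ ≤ F y * (D * ∫⁻ t in Metric.closedBall y 1, V t) := mul_le_mul_right this _
    _ = _ := by ring

/-- The weight of `decayNorm`, squared: `(1 + |y|²)⁻²ᴸ`. -/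
noncomputable def decaySq {n : ℕ} (L : ℕ) (y : Eu n) : ℝ≥0∞ :=
  ENNReal.ofReal ((bracketSq y ^ (2 * L))⁻¹)

theorem measurable_decaySq {n : ℕ} (L : ℕ) : Measurable (decaySq (n := n) L) :=
  ENNReal.measurable_ofReal.comp
    (contDiff_inv_bracketSq_pow (r := 0) (2 * L)).continuous.measurable

theorem decayNorm_sq {n : ℕ} (L : ℕ) (s : Eu n) (f : Eu n → ℂ) :
    decayNorm L s f ^ 2 = ∫⁻ y, decaySq L (y - s) * ‖f y‖ₑ ^ 2 := by
  unfold decayNorm decaySq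
  rw [eLpNorm_two_sq]
  refine lintegral_congr fun y => ?_
  have hb := bracketSq_pos (y - s)
  rw [enorm_smul, mul_pow, Real.enorm_of_nonneg (by positivity), ← ENNReal.ofReal_pow
    (by positivity), inv_pow, ← pow_mul, mul_comm L 2]

theorem lintegral_inv_bracketSq_pow_ne_top {n k : ℕ} (hk : n < 2 * k) :
    ∫⁻ y : Eu n, ENNReal.ofReal ((bracketSq y ^ k)⁻¹) ≠ ⊤ :=
  ((integrable_inv_bracketSq_pow hk).lintegral_lt_top).ne

theorem lintegral_decaySq_ne_top {n L : ℕ} (hL : n < 4 * L) :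
    ∫⁻ y : Eu n, decaySq L y ≠ ⊤ :=
  lintegral_inv_bracketSq_pow_ne_top (by omega)

/-! ### Weighted `L²` spaces -/

theorem lambdaWeight_pos {n : ℕ} (m : ℝ) (x : Eu n) : 0 < lambdaWeight m x :=
  Real.rpow_pos_of_pos (bracketSq_pos x) _

/-- Peetre's inequality for the weights `λ_m`. -/
theorem lambdaWeight_le {n k : ℕ} {m : ℝ} (hm : |m| ≤ 2 * k) (s y : Eu n) :
    lambdaWeight m s ≤ (2 * bracketSq (y - s)) ^ k * lambdaWeight m y := by
  have hs := bracketSq_pos s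
  have hy := bracketSq_pos y
  have hd := one_le_bracketSq (y - s)
  have hpow : (2 * bracketSq (y - s)) ^ |(-m / 2)| ≤ (2 * bracketSq (y - s)) ^ k := by
    rw [← Real.rpow_natCast]
    refine Real.rpow_le_rpow_of_exponent_le (by linarith) ?_
    rw [abs_div, abs_neg, abs_two]
    linarith
  change bracketSq s ^ (-m / 2) ≤ _ * bracketSq y ^ (-m / 2)
  refine le_trans ?_ (mul_le_mul_of_nonneg_right hpow (by positivity))
  rcases le_total 0 (-m / 2) with h | h
  · rw [abs_of_nonneg h, ← Real.mul_rpow (by positivity) hy.le]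
    refine Real.rpow_le_rpow hs.le ?_ h
    have := bracketSq_add_le y (s - y)
    rw [add_sub_cancel, ← neg_sub y s, bracketSq_neg] at this
    linarith
  · rw [abs_of_nonpos h]
    have key : bracketSq y ≤ 2 * bracketSq (y - s) * bracketSq s := by
      have := bracketSq_add_le s (y - s)
      rw [add_sub_cancel] at this
      linarith
    have h' : 0 ≤ -(-m / 2) := by linarith
    have := Real.rpow_le_rpow hy.le key h'
    rw [Real.mul_rpow (by positivity) hs.le] at this
    rw [show (-m / 2) = -(-(-m / 2)) by ring, Real.rpow_neg hs.le, Real.rpow_neg hy.le, neg_neg,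
      ← div_eq_mul_inv, inv_eq_one_div, div_le_div_iff₀ (by positivity) (by positivity), one_mul]
    exact this

theorem continuous_lambdaWeight {n : ℕ} (m : ℝ) : Continuous (lambdaWeight (n := n) m) :=
  (contDiff_bracketSq (r := 0)).continuous.rpow_const fun x => Or.inl (bracketSq_pos x).ne'

theorem measurable_ofReal_lambdaWeight {n : ℕ} (m : ℝ) :
    Measurable fun x : Eu n => ENNReal.ofReal (lambdaWeight m x) :=
  ENNReal.measurable_ofReal.comp (continuous_lambdaWeight m).measurable

theorem eLpNorm_weightMeasure_sq {n : ℕ} (m : ℝ) (f : Eu n → ℂ) :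
    eLpNorm f 2 (weightMeasure n m) ^ 2 =
      ∫⁻ x, ENNReal.ofReal (lambdaWeight m x) * ‖f x‖ₑ ^ 2 := by
  rw [eLpNorm_two_sq, weightMeasure, lintegral_withDensity_eq_lintegral_mul_non_measurable _
    (measurable_ofReal_lambdaWeight m) (Filter.Eventually.of_forall fun x => ENNReal.ofReal_lt_top)]
  rfl

theorem volume_absolutelyContinuous_weightMeasure (n : ℕ) (m : ℝ) :
    (volume : Measure (Eu n)) ≪ weightMeasure n m :=
  withDensity_absolutelyContinuous' (measurable_ofReal_lambdaWeight m).aemeasurable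
    (Filter.Eventually.of_forall fun x => by simpa using lambdaWeight_pos m x)

/-- The decay order `k + n + 1` pays for the loss `(1 + |y - s|²)ᵏ` in Peetre's inequality and still
leaves an integrable weight. -/
theorem lambdaWeight_mul_decaySq_le {n k : ℕ} {m : ℝ} (hm : |m| ≤ 2 * k) (s y : Eu n) :
    ENNReal.ofReal (lambdaWeight m s) * decaySq (k + n + 1) (y - s) ≤
      2 ^ k * ENNReal.ofReal (lambdaWeight m y) *
        ENNReal.ofReal ((bracketSq (y - s) ^ (n + 1))⁻¹) := by
  have hb := one_le_bracketSq (y - s)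
  have hb0 := bracketSq_pos (y - s)
  have hl := lambdaWeight_pos m y
  have h2 : (2 : ℝ≥0∞) ^ k = ENNReal.ofReal (2 ^ k) := by
    rw [ENNReal.ofReal_pow (by norm_num)]; simp
  unfold decaySq
  rw [h2, ← ENNReal.ofReal_mul (lambdaWeight_pos m s).le, ← ENNReal.ofReal_mul (by positivity),
    ← ENNReal.ofReal_mul (by positivity)]
  refine ENNReal.ofReal_le_ofReal ?_
  calc lambdaWeight m s * (bracketSq (y - s) ^ (2 * (k + n + 1)))⁻¹
      ≤ ((2 * bracketSq (y - s)) ^ k * lambdaWeight m y) *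
          (bracketSq (y - s) ^ (k + (n + 1)))⁻¹ := by
        refine mul_le_mul (lambdaWeight_le hm s y) ?_ (by positivity) (by positivity)
        exact inv_anti₀ (by positivity) (pow_le_pow_right₀ hb (by omega))
    _ = _ := by
        rw [mul_pow, pow_add]
        field_simp

theorem decayNorm_sq_le_weightMeasure {n k : ℕ} {m : ℝ} (hm : |m| ≤ 2 * k) (f : Eu n → ℂ) :
    decayNorm (k + n + 1) 0 f ^ 2 ≤ 2 ^ k * eLpNorm f 2 (weightMeasure n m) ^ 2 := by
  rw [decayNorm_sq, eLpNorm_weightMeasure_sq, ← lintegral_const_mul' _ _ (by finiteness)]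
  refine lintegral_mono fun y => ?_
  rw [← mul_assoc]
  refine mul_le_mul_left ?_ _
  have h := lambdaWeight_mul_decaySq_le hm 0 y
  have h0 : lambdaWeight m (0 : Eu n) = 1 := by simp [lambdaWeight]
  rw [h0, ENNReal.ofReal_one, one_mul] at h
  refine h.trans (mul_le_of_le_one_right' ?_)
  rw [ENNReal.ofReal_le_one]
  exact inv_le_one_of_one_le₀ (one_le_pow₀ (one_le_bracketSq _))

/-- Integrating the decaying norms of `f` over their centres against `λ_m` gives back the
weighted norm. -/
theorem lintegral_lambdaWeight_mul_decayNorm_sq_le {n k : ℕ} {m : ℝ} (hm : |m| ≤ 2 * k)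
    {f : Eu n → ℂ} (hf : AEStronglyMeasurable f volume) :
    ∫⁻ s, ENNReal.ofReal (lambdaWeight m s) * decayNorm (k + n + 1) s f ^ 2 ≤
      2 ^ k * (∫⁻ y : Eu n, ENNReal.ofReal ((bracketSq y ^ (n + 1))⁻¹)) *
        eLpNorm f 2 (weightMeasure n m) ^ 2 := by
  set W := ∫⁻ y : Eu n, ENNReal.ofReal ((bracketSq y ^ (n + 1))⁻¹) with hW
  have hWtop : W ≠ ⊤ := lintegral_inv_bracketSq_pow_ne_top (by omega)
  have hfm : AEMeasurable fun y => ‖f y‖ₑ ^ 2 := hf.enorm.pow_const 2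
  have hdm : Measurable fun p : Eu n × Eu n => decaySq (k + n + 1) (p.2 - p.1) :=
    (measurable_decaySq _).comp (measurable_snd.sub measurable_fst)
  calc ∫⁻ s, ENNReal.ofReal (lambdaWeight m s) * decayNorm (k + n + 1) s f ^ 2
      = ∫⁻ s, ∫⁻ y, ENNReal.ofReal (lambdaWeight m s) *
          (decaySq (k + n + 1) (y - s) * ‖f y‖ₑ ^ 2) := by
        refine lintegral_congr fun s => ?_
        rw [decayNorm_sq, lintegral_const_mul' _ _ ENNReal.ofReal_ne_top]
    _ = ∫⁻ y, ∫⁻ s, ENNReal.ofReal (lambdaWeight m s) *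
          (decaySq (k + n + 1) (y - s) * ‖f y‖ₑ ^ 2) := by
        refine lintegral_lintegral_swap ?_
        exact ((measurable_ofReal_lambdaWeight m).comp measurable_fst).aemeasurable.mul
          (hdm.aemeasurable.mul hfm.comp_snd)
    _ ≤ ∫⁻ y, (2 ^ k * ENNReal.ofReal (lambdaWeight m y) * ‖f y‖ₑ ^ 2) * W := by
        refine lintegral_mono fun y => ?_
        have hWy : W = ∫⁻ s : Eu n, ENNReal.ofReal ((bracketSq (y - s) ^ (n + 1))⁻¹) :=
          (lintegral_sub_left_eq_self
            (fun s : Eu n => ENNReal.ofReal ((bracketSq s ^ (n + 1))⁻¹)) y).symm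
        rw [hWy, ← lintegral_const_mul' _ _ (by finiteness)]
        refine lintegral_mono fun s => ?_
        calc ENNReal.ofReal (lambdaWeight m s) * (decaySq (k + n + 1) (y - s) * ‖f y‖ₑ ^ 2)
            = ENNReal.ofReal (lambdaWeight m s) * decaySq (k + n + 1) (y - s) * ‖f y‖ₑ ^ 2 := by
              ring
          _ ≤ 2 ^ k * ENNReal.ofReal (lambdaWeight m y) *
                ENNReal.ofReal ((bracketSq (y - s) ^ (n + 1))⁻¹) * ‖f y‖ₑ ^ 2 :=
              mul_le_mul_left (lambdaWeight_mul_decaySq_le hm s y) _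
          _ = _ := by ring
    _ = _ := by
        rw [lintegral_mul_const' _ _ hWtop, eLpNorm_weightMeasure_sq]
        simp only [mul_assoc]
        rw [lintegral_const_mul' (2 ^ k) _ (by finiteness)]
        ring

/-- The bound on `L²(λ_m dx)`, for all `m` with `|m| ≤ 2k` at once. -/
theorem exists_eLpNorm_weightMeasure_le (n k : ℕ) (A : ℝ) : ∃ C : ℝ≥0,
    ∀ a : Eu n × Eu n → ℂ, IsBddSymbol a →
      DerivBound (2 * (n + 1) + 2 * (k + n + 1)) A a → ∀ m : ℝ, |m| ≤ 2 * k →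
      ∀ f g : Eu n → ℂ, AEStronglyMeasurable f volume → IsPsiOf a f g →
        eLpNorm g 2 (weightMeasure n m) ≤ C * eLpNorm f 2 (weightMeasure n m) := by
  obtain ⟨C₀, hC₀, h⟩ := exists_eLpNorm_ball_le_decayNorm n (k + n + 1) zero_lt_one
  set W := ∫⁻ y : Eu n, ENNReal.ofReal ((bracketSq y ^ (n + 1))⁻¹) with hW
  have hWtop : W ≠ ⊤ := lintegral_inv_bracketSq_pow_ne_top (by omega)
  set v := volume (Metric.closedBall (0 : Eu n) 1) with hv
  have hv0 : v ≠ 0 := (Metric.measure_closedBall_pos _ _ zero_lt_one).ne'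
  have hvtop : v ≠ ⊤ := measure_closedBall_lt_top.ne
  set c := ENNReal.ofReal (C₀ * A + 1) with hc
  set Q : ℝ≥0∞ := v⁻¹ * (4 ^ k * (c ^ 2 * (2 ^ k * W))) with hQ
  have hQtop : Q ≠ ⊤ := by
    have : v⁻¹ ≠ ⊤ := ENNReal.inv_ne_top.2 hv0
    finiteness
  -- `Q + 1` is a convenient upper bound for the square root of `Q`.
  refine ⟨(Q + 1).toNNReal, fun a ha hA m hm f g hf hg => ?_⟩
  rw [ENNReal.coe_toNNReal (by finiteness)]
  have hgm : AEMeasurable fun y => ‖g y‖ₑ ^ 2 := hg.1.aestronglyMeasurable.enorm.pow_const 2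
  have hslow : ∀ t y : Eu n, dist t y ≤ 1 →
      ENNReal.ofReal (lambdaWeight m y) ≤ 4 ^ k * ENNReal.ofReal (lambdaWeight m t) := by
    intro t y hty
    have h4 : (4 : ℝ≥0∞) ^ k = ENNReal.ofReal (4 ^ k) := by
      rw [ENNReal.ofReal_pow (by norm_num)]; simp
    rw [h4, ← ENNReal.ofReal_mul (by positivity)]
    refine ENNReal.ofReal_le_ofReal ((lambdaWeight_le hm y t).trans ?_)
    refine mul_le_mul_of_nonneg_right (pow_le_pow_left₀ ?_ ?_ k) (lambdaWeight_pos m t).le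
    · linarith [bracketSq_pos (t - y)]
    · rw [dist_eq_norm] at hty
      unfold bracketSq
      nlinarith [norm_nonneg (t - y)]
  have hsq : eLpNorm g 2 (weightMeasure n m) ^ 2 ≤ Q * eLpNorm f 2 (weightMeasure n m) ^ 2 := by
    have h1 := lintegral_mul_le_lintegral_average (measurable_ofReal_lambdaWeight m) hgm
      (D := 4 ^ k) (by finiteness) hslow
    rw [← eLpNorm_weightMeasure_sq] at h1
    have h2 : ∫⁻ t, ENNReal.ofReal (lambdaWeight m t) *
        ∫⁻ y in Metric.closedBall t 1, ‖g y‖ₑ ^ 2 ≤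
        c ^ 2 * (2 ^ k * W * eLpNorm f 2 (weightMeasure n m) ^ 2) := by
      calc ∫⁻ t, ENNReal.ofReal (lambdaWeight m t) * ∫⁻ y in Metric.closedBall t 1, ‖g y‖ₑ ^ 2
          ≤ ∫⁻ t, c ^ 2 * (ENNReal.ofReal (lambdaWeight m t) *
              decayNorm (k + n + 1) t f ^ 2) := by
            refine lintegral_mono fun t => ?_
            rw [← eLpNorm_two_sq]
            have := pow_le_pow_left' (h a ha A hA f g hf hg t) 2
            rw [mul_pow] at this
            refine (mul_le_mul_right this _).trans (le_of_eq ?_)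
            ring
        _ ≤ _ := by
            rw [lintegral_const_mul' _ _ (by finiteness)]
            exact mul_le_mul_right (lintegral_lambdaWeight_mul_decayNorm_sq_le hm hf) _
    calc eLpNorm g 2 (weightMeasure n m) ^ 2
        = v⁻¹ * (v * eLpNorm g 2 (weightMeasure n m) ^ 2) := by
          rw [← mul_assoc, ENNReal.inv_mul_cancel hv0 hvtop, one_mul]
      _ ≤ v⁻¹ * (4 ^ k * (c ^ 2 * (2 ^ k * W * eLpNorm f 2 (weightMeasure n m) ^ 2))) :=
          mul_le_mul_right (h1.trans (mul_le_mul_right h2 _)) _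
      _ = _ := by rw [hQ]; ring
  refine (ENNReal.pow_le_pow_left_iff (two_ne_zero)).1 (hsq.trans ?_)
  rw [mul_pow]
  refine mul_le_mul_left ?_ _
  calc Q ≤ (Q + 1) * 1 := by rw [mul_one]; exact le_self_add
    _ ≤ (Q + 1) * (Q + 1) := mul_le_mul_right le_add_self _
    _ = (Q + 1) ^ 2 := (sq _).symm

/-! ### The unit cube norm -/

/-- The lattice point `μ ∈ ℤⁿ` as a vector. -/
noncomputable def latticePoint {n : ℕ} (μ : Fin n → ℤ) : Eu n :=
  WithLp.toLp 2 fun i => (μ i : ℝ)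

theorem unitCube_subset_closedBall {n : ℕ} (μ : Fin n → ℤ) :
    unitCube μ ⊆ Metric.closedBall (latticePoint μ) (n + 1) := by
  intro x hx
  rw [Metric.mem_closedBall, dist_eq_norm]
  refine le_of_sq_le_sq ?_ (by positivity)
  rw [EuclideanSpace.norm_sq_eq]
  calc ∑ i, ‖(x - latticePoint μ) i‖ ^ 2 ≤ ∑ _i : Fin n, (1 : ℝ) := by
        refine Finset.sum_le_sum fun i _ => ?_
        have h := hx i
        rw [Real.norm_eq_abs, sq_abs]
        simp only [latticePoint, PiLp.sub_apply]
        nlinarith [h.1, h.2]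
    _ = n := by simp
    _ ≤ ((n : ℝ) + 1) ^ 2 := by
        have : (0 : ℝ) ≤ n := Nat.cast_nonneg n
        nlinarith

/-- A ball of radius `1` is covered by `3ⁿ` unit cubes. -/
theorem lintegral_closedBall_le_cubeNorm {n : ℕ} (f : Eu n → ℂ) (t : Eu n) :
    ∫⁻ y in Metric.closedBall t 1, ‖f y‖ₑ ^ 2 ≤ 3 ^ n * cubeNorm f ^ 2 := by
  let μ : (Fin n → Fin 3) → Fin n → ℤ := fun ε i => ⌊t i⌋ + ((ε i : ℕ) : ℤ) - 1
  have hcov : Metric.closedBall t 1 ⊆ ⋃ ε, unitCube (μ ε) := by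
    intro y hy
    have hd : ∀ i, |y i - t i| ≤ 1 := fun i => by
      have h1 := PiLp.norm_apply_le (y - t) i
      rw [Metric.mem_closedBall, dist_eq_norm] at hy
      rw [← Real.norm_eq_abs]
      exact h1.trans hy
    have hfl : ∀ i, ∃ e : Fin 3, ⌊y i⌋ = ⌊t i⌋ + ((e : ℕ) : ℤ) - 1 := by
      intro i
      have h := abs_le.1 (hd i)
      have hlo : ⌊t i⌋ - 1 ≤ ⌊y i⌋ := by
        rw [Int.le_floor]
        push_cast
        linarith [Int.floor_le (t i)]
      have hhi : ⌊y i⌋ ≤ ⌊t i⌋ + 1 := by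
        rw [← Int.lt_add_one_iff, Int.floor_lt]
        push_cast
        linarith [Int.lt_floor_add_one (t i)]
      refine ⟨⟨(⌊y i⌋ - ⌊t i⌋ + 1).toNat, by omega⟩, ?_⟩
      simp only
      omega
    choose ε hε using hfl
    refine Set.mem_iUnion.2 ⟨ε, fun i => ?_⟩
    have e : μ ε i = ⌊y i⌋ := (hε i).symm
    rw [e]
    exact ⟨Int.floor_le _, (Int.lt_floor_add_one _).le⟩
  calc ∫⁻ y in Metric.closedBall t 1, ‖f y‖ₑ ^ 2
      ≤ ∫⁻ y in ⋃ ε, unitCube (μ ε), ‖f y‖ₑ ^ 2 := lintegral_mono_set hcov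
    _ ≤ ∑' ε, ∫⁻ y in unitCube (μ ε), ‖f y‖ₑ ^ 2 := lintegral_iUnion_le _ _
    _ = ∑ ε, ∫⁻ y in unitCube (μ ε), ‖f y‖ₑ ^ 2 := tsum_fintype _
    _ ≤ ∑ _ε : Fin n → Fin 3, cubeNorm f ^ 2 := by
        refine Finset.sum_le_sum fun ε _ => ?_
        rw [← eLpNorm_two_sq]
        exact pow_le_pow_left' (le_iSup (fun μ : Fin n → ℤ =>
          eLpNorm f 2 ((volume : Measure (Eu n)).restrict (unitCube μ))) (μ ε)) 2
    _ = _ := by simp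

/-- The square of a decaying norm is a weighted average of squared `L²` norms over unit balls. -/
theorem exists_decayNorm_le_cubeNorm (n : ℕ) : ∃ C : ℝ≥0∞, C ≠ ⊤ ∧
    ∀ (f : Eu n → ℂ), AEStronglyMeasurable f volume → ∀ s : Eu n,
      decayNorm (n + 1) s f ^ 2 ≤ C * cubeNorm f ^ 2 := by
  set W := ∫⁻ y : Eu n, decaySq (n + 1) y with hW
  have hWtop : W ≠ ⊤ := lintegral_decaySq_ne_top (by omega)
  set v := volume (Metric.closedBall (0 : Eu n) 1) with hv
  have hv0 : v ≠ 0 := (Metric.measure_closedBall_pos _ _ zero_lt_one).ne'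
  have hvtop : v ≠ ⊤ := measure_closedBall_lt_top.ne
  refine ⟨v⁻¹ * (4 ^ (2 * (n + 1)) * (W * 3 ^ n)), ?_, fun f hf s => ?_⟩
  · have : v⁻¹ ≠ ⊤ := ENNReal.inv_ne_top.2 hv0
    finiteness
  have hfm : AEMeasurable fun y => ‖f y‖ₑ ^ 2 := hf.enorm.pow_const 2
  have hVm : Measurable fun t : Eu n => decaySq (n + 1) (t - s) :=
    (measurable_decaySq _).comp (measurable_id.sub_const s)
  have hslow : ∀ t y : Eu n, dist t y ≤ 1 →
      decaySq (n + 1) (y - s) ≤ 4 ^ (2 * (n + 1)) * decaySq (n + 1) (t - s) := by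
    intro t y hty
    have h4 : (4 : ℝ≥0∞) ^ (2 * (n + 1)) = ENNReal.ofReal (4 ^ (2 * (n + 1))) := by
      rw [ENNReal.ofReal_pow (by norm_num)]; simp
    unfold decaySq
    rw [h4, ← ENNReal.ofReal_mul (by positivity)]
    refine ENNReal.ofReal_le_ofReal ?_
    have hy := bracketSq_pos (y - s)
    have ht := bracketSq_pos (t - s)
    rw [← div_eq_mul_inv, le_div_iff₀ (by positivity), inv_mul_le_iff₀ (by positivity), mul_comm,
      ← mul_pow]
    refine pow_le_pow_left₀ ht.le ?_ _
    have h1 := bracketSq_add_le (t - y) (y - s)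
    rw [sub_add_sub_cancel] at h1
    have h2 : bracketSq (t - y) ≤ 2 := by
      rw [dist_eq_norm] at hty
      unfold bracketSq
      nlinarith [norm_nonneg (t - y)]
    nlinarith
  have h1 := lintegral_mul_le_lintegral_average hVm hfm (by finiteness) hslow
  rw [← decayNorm_sq] at h1
  have h2 : ∫⁻ t, decaySq (n + 1) (t - s) * ∫⁻ y in Metric.closedBall t 1, ‖f y‖ₑ ^ 2 ≤
      W * (3 ^ n * cubeNorm f ^ 2) := by
    have hWs : W = ∫⁻ t : Eu n, decaySq (n + 1) (t - s) :=
      (lintegral_sub_right_eq_self (fun t : Eu n => decaySq (n + 1) t) s).symm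
    rw [hWs, ← lintegral_mul_const _ hVm]
    exact lintegral_mono fun t => mul_le_mul_right (lintegral_closedBall_le_cubeNorm f t) _
  calc decayNorm (n + 1) s f ^ 2 = v⁻¹ * (v * decayNorm (n + 1) s f ^ 2) := by
        rw [← mul_assoc, ENNReal.inv_mul_cancel hv0 hvtop, one_mul]
    _ ≤ v⁻¹ * (4 ^ (2 * (n + 1)) * (W * (3 ^ n * cubeNorm f ^ 2))) :=
        mul_le_mul_right (h1.trans (mul_le_mul_right h2 _)) _
    _ = _ := by ring

theorem exists_cubeNorm_le (n : ℕ) (A : ℝ) : ∃ C : ℝ≥0,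
    ∀ a : Eu n × Eu n → ℂ, IsBddSymbol a → DerivBound (2 * (n + 1) + 2 * (n + 1)) A a →
      ∀ f g : Eu n → ℂ, AEStronglyMeasurable f volume → IsPsiOf a f g →
        cubeNorm g ≤ C * cubeNorm f := by
  obtain ⟨C₀, hC₀, h⟩ := exists_eLpNorm_ball_le_decayNorm n (n + 1)
    (R := (n : ℝ) + 1) (by positivity)
  obtain ⟨Q, hQ, hdecay⟩ := exists_decayNorm_le_cubeNorm n
  set c := ENNReal.ofReal (C₀ * A + 1) with hc
  -- `Q + 1` is a convenient upper bound for the square root of `Q`.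
  refine ⟨(c * (Q + 1)).toNNReal, fun a ha hA f g hf hg => ?_⟩
  rw [ENNReal.coe_toNNReal (by finiteness)]
  refine iSup_le fun μ => ?_
  calc eLpNorm g 2 (volume.restrict (unitCube μ))
      ≤ eLpNorm g 2 (volume.restrict (Metric.closedBall (latticePoint μ) (n + 1))) :=
        eLpNorm_mono_measure _ (Measure.restrict_mono (unitCube_subset_closedBall μ) le_rfl)
    _ ≤ c * decayNorm (n + 1) (latticePoint μ) f := h a ha A hA f g hf hg _
    _ ≤ c * ((Q + 1) * cubeNorm f) := by
        refine mul_le_mul_right ((ENNReal.pow_le_pow_left_iff two_ne_zero).1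
          ((hdecay f hf (latticePoint μ)).trans ?_)) _
        rw [mul_pow]
        refine mul_le_mul_left ?_ _
        calc Q ≤ (Q + 1) * 1 := by rw [mul_one]; exact le_self_add
          _ ≤ (Q + 1) * (Q + 1) := mul_le_mul_right le_add_self _
          _ = (Q + 1) ^ 2 := (sq _).symm
    _ = _ := (mul_assoc _ _ _).symm

theorem theoremT (n : ℕ) :
    -- on Schwartz functions the operator is given by the integral formula
    (∀ a : Eu n × Eu n → ℂ, IsSymbol 0 a → ∀ f : 𝓢(Eu n, ℂ), IsPsiOf a f (psiOp a f)) ∧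
    -- boundedness on the weighted spaces
    (∀ M : ℝ, ∃ N : ℕ, 0 < N ∧ ∀ A : ℝ, ∃ C : ℝ≥0, ∀ m : ℝ, |m| = M →
      ∀ a : Eu n × Eu n → ℂ, IsSymbol 0 a → SymbolBound 0 N A a →
      ∀ f : Eu n → ℂ, MemLp f 2 (weightMeasure n m) →
        (∃ g : Eu n → ℂ, IsPsiOf a f g) ∧
        ∀ g : Eu n → ℂ, IsPsiOf a f g →
          MemLp g 2 (weightMeasure n m) ∧
          eLpNorm g 2 (weightMeasure n m) ≤ C * eLpNorm f 2 (weightMeasure n m)) ∧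
    -- boundedness in the unit cube norm
    (∃ N : ℕ, ∀ A : ℝ, ∃ C : ℝ≥0,
      ∀ a : Eu n × Eu n → ℂ, IsSymbol 0 a → SymbolBound 0 N A a →
      ∀ f : Eu n → ℂ, AEStronglyMeasurable f volume → cubeNorm f < ⊤ →
        (∃ g : Eu n → ℂ, IsPsiOf a f g) ∧
        ∀ g : Eu n → ℂ, IsPsiOf a f g → cubeNorm g ≤ C * cubeNorm f) := by
  refine ⟨fun a ha f => ha.isBddSymbol.isPsiOf_psiOp f, fun M => ?_, ?_⟩
  -- `k` is chosen with `|m| ≤ 2k`, so that `λ_m` varies at most like `(1 + |x|²)ᵏ`.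
  · set k := ⌈M / 2⌉₊ with hk
    have hM : ∀ m : ℝ, |m| = M → |m| ≤ 2 * k := fun m hm => by
      have := Nat.le_ceil (M / 2)
      rw [hm]
      linarith
    obtain ⟨C₁, hC₁, hconv⟩ :=
      exists_derivBound_of_symbolBound n (2 * (n + 1) + 2 * (k + n + 1))
    refine ⟨2 * (n + 1) + 2 * (k + n + 1), by omega, fun A => ?_⟩
    obtain ⟨C, hC⟩ := exists_eLpNorm_weightMeasure_le n k (C₁ * A)
    refine ⟨C, fun m hm a ha hA f hf => ?_⟩
    have hfm : AEStronglyMeasurable f volume :=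
      hf.1.mono_ac (volume_absolutelyContinuous_weightMeasure n m)
    refine ⟨ha.isBddSymbol.exists_isPsiOf (L := k + n + 1) hfm ?_, fun g hg => ?_⟩
    · have h2 : decayNorm (k + n + 1) 0 f ^ 2 < ⊤ := by
        refine (decayNorm_sq_le_weightMeasure (hM m hm) f).trans_lt ?_
        have := hf.2.ne
        exact ENNReal.mul_lt_top (by finiteness) (by finiteness)
      exact (ENNReal.pow_lt_top_iff.1 h2).resolve_right two_ne_zero
    · have hle := hC a ha.isBddSymbol (hconv a A ha.1 hA) m (hM m hm) f g hfm hg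
      refine ⟨⟨?_, hle.trans_lt (ENNReal.mul_lt_top ENNReal.coe_lt_top hf.2)⟩, hle⟩
      exact hg.1.aestronglyMeasurable.mono_ac (withDensity_absolutelyContinuous _ _)
  · obtain ⟨C₁, hC₁, hconv⟩ := exists_derivBound_of_symbolBound n (2 * (n + 1) + 2 * (n + 1))
    refine ⟨2 * (n + 1) + 2 * (n + 1), fun A => ?_⟩
    obtain ⟨C, hC⟩ := exists_cubeNorm_le n (C₁ * A)
    obtain ⟨Q, hQ, hdecay⟩ := exists_decayNorm_le_cubeNorm n
    refine ⟨C, fun a ha hA f hf hcube => ⟨?_, fun g hg => ?_⟩⟩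
    · refine ha.isBddSymbol.exists_isPsiOf (L := n + 1) hf ?_
      have h2 : decayNorm (n + 1) 0 f ^ 2 < ⊤ := by
        refine (hdecay f hf 0).trans_lt ?_
        have := hcube.ne
        exact ENNReal.mul_lt_top (by finiteness) (by finiteness)
      exact (ENNReal.pow_lt_top_iff.1 h2).resolve_right two_ne_zero
    · exact hC a ha.isBddSymbol (hconv a A ha.1 hA) f g hf hg
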